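/- **Setup.** Let $\mathcal L_\alpha,\mathcal L_\beta$ be first-order languages such that every function symbol (including constants) of $\mathcal L_\alpha$ is in $\mathcal L_\beta$, let $\mathcal L=\mathcal L_\alpha\cap\mathcal L_\beta$, let $A$ be a new unary predicate symbol and $\mathcal L^2=\mathcal L_\alpha\cup\mathcal L_\beta\cup\{A\}$. Let $T_\alpha$ be a consistent $\mathcal L_\alpha$-theory and $T_\beta$ a consistent $\mathcal L_\beta$-theory. Assume $T_\beta$ is *geometric*: it eliminates $\exists^\infty$, and algebraic closure $\operatorname{acl}$ is a pregeometry in each of its models. For an $\mathcal L_\alpha$-formula $\theta$ let $\theta_A$ be the $\mathcal L^2$-formula obtained by relativizing all quantifiers to $A$. Let $T^2$ be the $\mathcal L^2$-theory consisting of $T_\beta$, all $\theta_A$ with $\theta$ a sentence and $T_\alpha\models\theta$, the axioms that $A$ is closed under the functions of $\mathcal L_\alpha$, and the axioms $R(\vec x)\to\bigwedge_i A(x_i)$ for the relation symbols $R\in\mathcal L_\alpha\setminus\mathcal L_\beta$. A model of $T^2$ is written $(\mathcal B,\mathcal A)$, where $\mathcal B$ is its $\mathcal L_\beta$-reduct and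 $\mathcal A$ is the $\mathcal L_\alpha$-structure induced on the set $A$; $\operatorname{acl}$ is computed in $\mathcal B$. For $X,Y,Z\subseteq B$ say that $X$ is independent from $Y$ over $Z$ if every subset of $X$ that is $\operatorname{acl}$-independent over $Z$ is $\operatorname{acl}$-independent over $Y\cup Z$. Types are complete and realizable in an elementary extension. **ML-theories.** An $\mathcal L^2$-theory $T$ is an *ML-theory* (Mordell–Lang theory of pairs) if 1. $T$ extends $T^2$; 2. (Mordell–Lang condition) Let $\vec x_\alpha$ be a subtuple of a finite tuple $\vec x$ of variables, $p(\vec x_\alpha)$ a complete $\mathcal L_\alpha$-type, $q(\vec x)$ a complete $\mathcal L_\beta$-type, $\phi(\vec x,y)$ an $\mathcal L_\beta$-formula with $q\models\exists^{<\infty}y\,\phi(\vec x,y)$, and $\psi(\vec x_\alpha,y)$ an $\mathcal L_\alpha$-formula. A *contender* is a model $(\mathcal B,\mathcal A)\models T$ with a tuple $\vec c$ in $B$ realizing $q$ whose subtuple $\vec c_\alpha$ of components in $A$ corresponds to $\vec x_\alpha$ and realizes $p_A=\{\theta_A:\theta\in p\}$, and such that $\vec c$ is independent from $A$ over $\vec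 c_\alpha$. A *solution* is a contender together with $a\in A$ such that $(\mathcal B,\mathcal A)\models\phi(\vec c,a)\wedge\psi_A(\vec c_\alpha,a)$. The condition: whenever $(p,q,\phi,\psi)$ has some solution, every contender extends to a solution. 3. For every cardinal $\kappa>|T^2|:=\max(\aleph_0,|\mathcal L^2|)$, every $\kappa$-saturated $(\mathcal B,\mathcal A)\models T$, every $C\subseteq B$ with $|C|<\kappa$ and every non-algebraic unary $\mathcal L_\beta(C)$-type $q$: (a) (density) if $p$ is a unary $\mathcal L_\alpha(A\cap C)$-type such that $q$ implies every quantifier-free $\mathcal L(A\cap C)$-formula in $p$, then some $a\in A$ realizes $p_A\cup q$; (b) (codensity) some $b\in B\setminus\operatorname{acl}(A\cup C)$ realizes $q$. For an $\mathcal L^2$-theory $T$ put $T_{\mathcal B}=\{\phi\ \mathcal L_\beta\text{-sentence}: T\models\phi\}$ and $T_{\mathcal A}=\{\phi\ \mathcal L_\alpha\text{-sentence}: T\models\phi_A\}$. Complete theories are understood to be consistent. **Corollary.** Let $T$ be a consistent ML-theory. Then - if $T_\alpha$ and $T_\beta$ are complete, then $T$ is complete; - $T$ is complete if and only if $T_{\mathcal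 A}$ and $T_{\mathcal B}$ are complete; - consequently, if $T_\alpha$ and $T_\beta$ axiomatize $T_{\mathcal A}$ and $T_{\mathcal B}$ respectively (that is, $T_\alpha\models T_{\mathcal A}$ and $T_\beta\models T_{\mathcal B}$), then $T$ is complete if and only if $T_\alpha$ and $T_\beta$ are complete. -/

import Mathlib

open FirstOrder FirstOrder.Language Cardinal

universe u v w

namespace MLPair

/-! ## General model-theoretic notions

An `L(C)`-formula `φ(x, c)` in one variable is represented by an `L`-formula whose free variables
are indexed by `C ⊕ Unit`; the variables in `C` are always evaluated at themselves. -/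

section General

variable (L : FirstOrder.Language.{u, v}) {N : Type w} [L.Structure N]

/-- `N ⊨ φ(c, b)` for an `L(C)`-formula `φ` in one variable. -/
def HoldsAt {C : Set N} (φ : L.Formula (C ⊕ Unit)) (b : N) : Prop :=
  φ.Realize (Sum.elim (fun c : C => (c : N)) (fun _ => b))

/-- `p` is finitely satisfiable in `N`. -/
def FinSat {C : Set N} (p : Set (L.Formula (C ⊕ Unit))) : Prop :=
  ∀ p₀ : Set (L.Formula (C ⊕ Unit)), p₀ ⊆ p → p₀.Finite → ∃ b : N, ∀ φ ∈ p₀, HoldsAt L φ b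

/-- A (complete, realizable in an elementary extension) unary `L(C)`-type of the structure `N`. -/
structure IsTypeOver (C : Set N) (p : Set (L.Formula (C ⊕ Unit))) : Prop where
  finSat : FinSat L p
  complete : ∀ φ : L.Formula (C ⊕ Unit), φ ∈ p ∨ φ.not ∈ p

/-- A type is non-algebraic if none of its formulas has only finitely many solutions. -/
def IsNonAlgebraic {C : Set N} (p : Set (L.Formula (C ⊕ Unit))) : Prop :=
  ∀ φ ∈ p, {b : N | HoldsAt L φ b}.Infinite

variable (N) in
/-- `N` is `κ`-saturated: every finitely satisfiable set of `L(C)`-formulas in one variable with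
`|C| < κ` is realized in `N`. -/
def IsSaturated (κ : Cardinal.{w}) : Prop :=
  ∀ C : Set N, #C < κ → ∀ p : Set (L.Formula (C ⊕ Unit)), FinSat L p →
    ∃ b : N, ∀ φ ∈ p, HoldsAt L φ b

/-- The model-theoretic algebraic closure of `C` in the `L`-structure `N`. -/
def acl (C : Set N) : Set N :=
  {b | ∃ φ : L.Formula (C ⊕ Unit), {y : N | HoldsAt L φ y}.Finite ∧ HoldsAt L φ b}

/-- `X` is `acl`-independent over `Z`. -/
def AclIndep (X Z : Set N) : Prop :=
  ∀ x ∈ X, x ∉ acl L (Z ∪ (X \ {x}))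

/-- `X` and `Y` are independent over `Z`: every subset of `X` that is `acl`-independent over `Z` is
`acl`-independent over `Y ∪ Z`. -/
def IndepOver (X Y Z : Set N) : Prop :=
  ∀ X₀ : Set N, X₀ ⊆ X → AclIndep L X₀ Z → AclIndep L X₀ (Y ∪ Z)

/-- The operator `cl` on subsets of `X` is a pregeometry. -/
structure IsPregeometry {X : Type w} (cl : Set X → Set X) : Prop where
  subset_cl : ∀ C, C ⊆ cl C
  mono : ∀ C D, C ⊆ D → cl C ⊆ cl D
  cl_cl : ∀ C, cl (cl C) = cl C
  finitary : ∀ C, ∀ a ∈ cl C, ∃ C₀ ⊆ C, C₀.Finite ∧ a ∈ cl C₀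
  exchange : ∀ C a b, a ∈ cl (insert b C) → a ∉ cl C → b ∈ cl (insert a C)

variable {L}

/-- `T` is geometric: it eliminates the quantifier `∃^∞`, and `acl` is a pregeometry in every model
of `T`. -/
structure IsGeometric (T : L.Theory) : Prop where
  elim_exists_infinite : ∀ (n : ℕ) (φ : L.Formula (Fin n ⊕ Unit)), ∃ ψ : L.Formula (Fin n),
    ∀ (N : Theory.ModelType.{u, v, max u v} T) (c : Fin n → N),
      ψ.Realize c ↔ {b : N | φ.Realize (Sum.elim c fun _ => b)}.Infinite
  pregeometry : ∀ N : Theory.ModelType.{u, v, max u v} T, IsPregeometry (acl L (N := N))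

/-- The formula `φ(x)` belongs to the (parameter-free) complete type `q(x)`. -/
def InType {T : L.Theory} {ι : Type} (q : T.CompleteType ι) (φ : L.Formula ι) : Prop :=
  Formula.equivSentence φ ∈ q

/-- The tuple `c` realizes the (parameter-free) complete type `q`. -/
def Realizes {T : L.Theory} {ι : Type} (q : T.CompleteType ι) (c : ι → N) : Prop :=
  ∀ φ : L.Formula ι, InType q φ → φ.Realize c

end General

/-! ## The languages

Writing `L` for the intersection of the two languages, `K` for the symbols of the `β`-language that
are not in `L` and `R` for the (relation) symbols of the `α`-language that are not in `L`, the
`β`-language is `L ∪ K` and the `α`-language is `L ∪ R`. So all function symbols (including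
constants, the nullary function symbols) of the `α`-language are in the `β`-language. -/

/-- The `α`-language `L ∪ R`. -/
def langA (L : FirstOrder.Language.{u, v}) (R : ℕ → Type v) : FirstOrder.Language.{u, v} :=
  L.sum ⟨fun _ => PEmpty.{u + 1}, R⟩

/-- The `β`-language `L ∪ K`. -/
def langB (L K : FirstOrder.Language.{u, v}) : FirstOrder.Language.{u, v} :=
  L.sum K

/-- A single unary predicate symbol, the symbol `A`. -/
inductive PredSymb : ℕ → Type v
  | A : PredSymb 1

/-- The language of pairs: the `β`-language together with the relation symbols `R` and `A`. -/
def langPair (L K : FirstOrder.Language.{u, v}) (R : ℕ → Type v) : FirstOrder.Language.{u, v} :=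
  (langB L K).sum ⟨fun _ => PEmpty.{u + 1}, fun n => R n ⊕ PredSymb.{v} n⟩

variable {L K : FirstOrder.Language.{u, v}} {R : ℕ → Type v}

/-- Inclusion of the common language in the `α`-language. -/
def inclA : L →ᴸ langA L R := LHom.sumInl

/-- Inclusion of the common language in the `β`-language. -/
def inclB : L →ᴸ langB L K := LHom.sumInl

/-- Inclusion of the `β`-language in the language of pairs. -/
def inclBPair : langB L K →ᴸ langPair L K R := LHom.sumInl

/-- The predicate symbol `A` of the language of pairs. -/
def symbA : (langPair L K R).Relations 1 := Sum.inr (Sum.inr PredSymb.A)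

/-- A symbol of `R` as a relation symbol of the language of pairs. -/
def symbR {n : ℕ} (r : R n) : (langPair L K R).Relations n := Sum.inr (Sum.inl r)

/-- Inclusion of the `α`-language in the language of pairs. -/
def inclAPair : langA L R →ᴸ langPair L K R :=
  (inclBPair.comp inclB).sumElim ⟨fun _ f => f.elim, fun _ r => symbR r⟩

/-- The formula `θ_A` obtained from the `α`-formula `θ` by relativizing all its quantifiers to the
predicate `A`. -/
def relativize {ι : Type w} : ∀ {n : ℕ}, (langA L R).BoundedFormula ι n →
    (langPair L K R).BoundedFormula ι n
  | _, .falsum => .falsum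
  | _, .equal t₁ t₂ => .equal (inclAPair.onTerm t₁) (inclAPair.onTerm t₂)
  | _, .rel r ts => .rel (inclAPair.onRelation r) fun i => inclAPair.onTerm (ts i)
  | _, .imp θ₁ θ₂ => (relativize θ₁).imp (relativize θ₂)
  | n, .all θ =>
      ((symbA.boundedFormula₁ (Term.var (Sum.inr (Fin.last n)))).imp (relativize θ)).all

/-- The formula `A(x_1) ∧ ... ∧ A(x_n)`. -/
noncomputable def allInA (n : ℕ) : (langPair L K R).BoundedFormula Empty n :=
  BoundedFormula.iInf fun i : Fin n => symbA.boundedFormula₁ (Term.var (Sum.inr i))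

/-- The axiom that `A` is closed under the function symbol `f` of the `α`-language. -/
noncomputable def closureAxiom {n : ℕ} (f : (langA L R).Functions n) :
    (langPair L K R).Sentence :=
  ((allInA n).imp (symbA.boundedFormula₁
    (Term.func (inclAPair.onFunction f) fun i : Fin n => Term.var (Sum.inr i)))).alls

/-- The axiom that the relation symbol `r` of the `α`-language, not in the `β`-language, holds only
for tuples in `A`. -/
noncomputable def supportAxiom {n : ℕ} (r : R n) : (langPair L K R).Sentence :=
  (((symbR r).boundedFormula fun i : Fin n => Term.var (Sum.inr i)).imp (allInA n)).alls

/-- The basic theory of pairs `T²` associated with `Tα` and `Tβ`. -/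
def pairTheory (Tα : (langA L R).Theory) (Tβ : (langB L K).Theory) : (langPair L K R).Theory :=
  inclBPair.onTheory Tβ ∪
  {σ | ∃ φ : (langA L R).Sentence, Tα ⊨ᵇ φ ∧ σ = relativize φ} ∪
  {σ | ∃ (n : ℕ) (f : (langA L R).Functions n), σ = closureAxiom f} ∪
  {σ | ∃ (n : ℕ) (r : R n), σ = supportAxiom r}

/-! ## Pairs -/

variable {Tα : (langA L R).Theory} {Tβ : (langB L K).Theory}

variable (Tα Tβ) in
/-- The models of the theory of pairs. -/
abbrev Pair := Theory.ModelType.{u, v, max u v} (pairTheory Tα Tβ)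

/-- The reduct `ℬ` of a pair to the `β`-language. -/
instance structureB (M : Pair Tα Tβ) : (langB L K).Structure M :=
  (inclBPair : langB L K →ᴸ langPair L K R).reduct M

/-- The reduct of a pair to the `α`-language. -/
instance structureA (M : Pair Tα Tβ) : (langA L R).Structure M :=
  (inclAPair : langA L R →ᴸ langPair L K R).reduct M

/-- The subset of a pair defined by the predicate `A`. -/
def setA (M : Pair Tα Tβ) : Set M :=
  {x | Structure.RelMap (symbA : (langPair L K R).Relations 1) ![x]}

theorem realize_allInA (M : Pair Tα Tβ) {n : ℕ} (e : Empty → M) (x : Fin n → M) :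
    (allInA (L := L) (K := K) (R := R) n).Realize e x ↔ ∀ i, x i ∈ setA M := by
  simp [allInA, setA, BoundedFormula.realize_iInf, BoundedFormula.realize_rel₁]

/-- The `α`-structure `𝒜` of a pair, the substructure of the reduct with underlying set `A`. -/
def small (M : Pair Tα Tβ) : (langA L R).Substructure M where
  carrier := setA M
  fun_mem := by
    intro n f x hx
    have h : (M : Type _) ⊨ (closureAxiom f : (langPair L K R).Sentence) :=
      Theory.realize_sentence_of_mem (pairTheory Tα Tβ) (Or.inl (Or.inr ⟨n, f, rfl⟩))
    have h2 := BoundedFormula.realize_alls.1 h x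
    rw [BoundedFormula.realize_imp, realize_allInA] at h2
    have h3 := h2 hx
    rw [BoundedFormula.realize_rel₁] at h3
    exact h3

/-! ## The Mordell-Lang condition -/

variable (Tα Tβ) in
/-- A Mordell-Lang challenge `(p, q, φ, ψ)`. The variables are `x = (x_i)_{i < n}` and `y`, and
`x_α` consists of the `x_i` with `i ∈ S`. -/
structure Challenge where
  n : ℕ
  S : Set (Fin n)
  p : Tα.CompleteType S
  q : Tβ.CompleteType (Fin n)
  φ : (langB L K).Formula (Fin n ⊕ Unit)
  ψ : (langA L R).Formula (S ⊕ Unit)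
  /-- `q(x) ⊨ ∃^{<∞} y φ(x, y)` -/
  finite : ∀ (N : Theory.ModelType.{u, v, max u v} Tβ) (c : Fin n → N), Realizes q c →
    {b : N | φ.Realize (Sum.elim c fun _ => b)}.Finite

/-- `(M, c)` is a contender: `c_α`, the part of `c` in `A`, corresponds to `x_α`; `c` realizes `q`
in `ℬ`; `c_α` realizes `p_A`; and `c` is independent from `A` over `c_α`. -/
structure Challenge.IsContender (Q : Challenge Tα Tβ) (M : Pair Tα Tβ) (c : Fin Q.n → M) :
    Prop where
  mem_iff : ∀ i, i ∈ Q.S ↔ c i ∈ setA M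
  realizes_q : Realizes Q.q c
  realizes_p : ∀ θ : (langA L R).Formula Q.S, InType Q.p θ →
    Formula.Realize (relativize (K := K) θ) fun i => c i
  indep : IndepOver (langB L K) (Set.range c) (setA M) (c '' Q.S)

/-- `(M, c, a)` is a solution. -/
structure Challenge.IsSolution (Q : Challenge Tα Tβ) (M : Pair Tα Tβ) (c : Fin Q.n → M) (a : M) :
    Prop where
  contender : Q.IsContender M c
  mem : a ∈ setA M
  holds_φ : Q.φ.Realize (Sum.elim c fun _ => a)
  holds_ψ : Formula.Realize (relativize (K := K) Q.ψ)
    (Sum.elim (fun i : Q.S => c i) fun _ => a)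

variable (Tα Tβ) in
/-- `T` satisfies the Mordell-Lang condition: if a challenge has a solution in some model of `T`,
then every contender in a model of `T` extends to a solution. -/
def MordellLangCondition (T : (langPair L K R).Theory) : Prop :=
  ∀ Q : Challenge Tα Tβ,
    (∃ (M : Pair Tα Tβ) (c : Fin Q.n → M) (a : M), (M : Type _) ⊨ T ∧ Q.IsSolution M c a) →
    ∀ (M : Pair Tα Tβ) (c : Fin Q.n → M), (M : Type _) ⊨ T → Q.IsContender M c →
      ∃ a : M, Q.IsSolution M c a

/-! ## Density and codensity -/

/-- The set `A ∩ C`, as a subset of the structure `𝒜`. -/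
def interA (M : Pair Tα Tβ) (C : Set M) : Set (small M) := {a | (a : M) ∈ C}

/-- The inclusion of `A ∩ C` in `C`. -/
def interAToC {M : Pair Tα Tβ} {C : Set M} (a : interA M C) : C := ⟨(a : small M), a.2⟩

/-- The density condition for the pair `M`, the parameter set `C` and the `β`-type `q` over `C`. The
third hypothesis says `q ⊨ qf (p|L)`. -/
def Density (M : Pair Tα Tβ) (C : Set M) (q : Set ((langB L K).Formula (C ⊕ Unit))) : Prop :=
  ∀ p : Set ((langA L R).Formula (interA M C ⊕ Unit)),
    IsTypeOver (langA L R) (interA M C) p →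
    (∀ χ : L.Formula (interA M C ⊕ Unit), χ.IsQF → inclA.onFormula χ ∈ p →
      (inclB.onFormula χ).relabel (Sum.map interAToC id) ∈ q) →
    ∃ a ∈ setA M,
      (∀ θ ∈ p, Formula.Realize (relativize (K := K) θ)
        (Sum.elim (fun c : interA M C => ((c : small M) : M)) fun _ => a)) ∧
      ∀ φ ∈ q, HoldsAt (langB L K) φ a

/-- The codensity condition for the pair `M`, the parameter set `C` and the `β`-type `q` over
`C`. -/
def Codensity (M : Pair Tα Tβ) (C : Set M) (q : Set ((langB L K).Formula (C ⊕ Unit))) : Prop :=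
  ∃ b : M, b ∉ acl (langB L K) (setA M ∪ C) ∧ ∀ φ ∈ q, HoldsAt (langB L K) φ b

variable (Tα Tβ) in
/-- `T` is a Mordell-Lang theory of pairs (over `Tα` and `Tβ`). -/
structure IsMLTheory (T : (langPair L K R).Theory) : Prop where
  extends_pairTheory : ∀ σ ∈ pairTheory Tα Tβ, T ⊨ᵇ σ
  mordellLang : MordellLangCondition Tα Tβ T
  density_codensity : ∀ (M : Pair Tα Tβ) (κ : Cardinal.{max u v}), (M : Type _) ⊨ T →
    max ℵ₀ (langPair L K R).card < κ → IsSaturated (langPair L K R) M κ →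
    ∀ C : Set M, #C < κ → ∀ q : Set ((langB L K).Formula (C ⊕ Unit)),
      IsTypeOver (langB L K) C q → IsNonAlgebraic (langB L K) q →
      Density M C q ∧ Codensity M C q

/-! ## The theories of the two components -/

/-- The set of all `α`-sentences that hold in `𝒜` for all models `(ℬ, 𝒜)` of `T`, expressed through
relativization. -/
def theoryA (T : (langPair L K R).Theory) : (langA L R).Theory :=
  {φ | T ⊨ᵇ (relativize φ : (langPair L K R).Sentence)}

/-- The set of all `β`-sentences that hold in `ℬ` for all models `(ℬ, 𝒜)` of `T`. -/
def theoryB (T : (langPair L K R).Theory) : (langB L K).Theory :=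
  {φ | T ⊨ᵇ (inclBPair.onSentence φ : (langPair L K R).Sentence)}

end MLPair

/-! The theorem is a back-and-forth argument. To show that two models of `T` are elementarily
equivalent, replace each by an elementarily equivalent κ-saturated model with κ the successor of
`max ℵ₀ |ℒ²|`, and consider partial isomorphisms of size below κ (`IsPartialIso`). Such a map
preserves `β`-formulas, preserves `α`-formulas on its part in `A`, and respects `A`. Moreover its
domain is algebraic over its part in `A` together with a set `X` that is independent over `A`, and
whose image is independent over `A` on the other side. This last clause makes suitable finite pieces
of the map independent from `A` over their part in `A`, which is what the Mordell–Lang condition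
asks of a contender.

A new element `a` falls into one of four cases. If `a ∈ A` is algebraic over the domain, the
Mordell–Lang condition and saturation provide an image; if `a ∈ A` is not, density does. If `a` is
not algebraic over `A` and the domain, codensity does, and `a` joins `X`. Otherwise `a ∉ A` is
algebraic over finitely many elements of `A` and the domain; these are added to the map, and then a
realization of the `β`-type of `a` that avoids `A` is taken.

The empty map belongs to the system as soon as the `ℬ` and the `𝒜` of the two models are
elementarily equivalent, which completeness of `T_ℬ` and `T_𝒜` ensures (`isComplete_of_components`).
Conversely, a complete `T` decides all `θ_A` and all `β`-sentences. The statements on `Tα` and `Tβ`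
follow by comparing them with `T_𝒜` and `T_ℬ`. -/

namespace MLPair

/-! ## Existence of saturated models -/

section Saturation

variable (L : FirstOrder.Language.{u, v}) (I : Type w)

/-- Names for the elements of a saturated model: `mk f p` names a realization of the type `p` over
the elements named by `f`. -/
inductive Name : Type max u v w
  | base : Name
  | mk (f : I → Name) (p : Set (L.Formula (I ⊕ Unit))) : Name

variable {L I} {M : Type w} [L.Structure M]

/-- With respect to the filter `F` on the interpretations of the names, either the type `p` is
finitely unsatisfiable over `f`, or `mk f p` realizes it. -/
def Name.Decided (F : Filter (Name L I → M)) (f : I → Name L I)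
    (p : Set (L.Formula (I ⊕ Unit))) : Prop :=
  (∃ p₀ ⊆ p, p₀.Finite ∧ ∀ᶠ v in F, ¬∃ x : M, ∀ φ ∈ p₀, φ.Realize (Sum.elim (v ∘ f) fun _ => x)) ∨
    ∀ φ ∈ p, ∀ᶠ v in F, φ.Realize (Sum.elim (v ∘ f) fun _ => v (.mk f p))

theorem Name.Decided.mono {F G : Filter (Name L I → M)} (h : G ≤ F) {f : I → Name L I}
    {p : Set (L.Formula (I ⊕ Unit))} (hF : Name.Decided F f p) : Name.Decided G f p :=
  hF.imp (fun ⟨p₀, h₁, h₂, h₃⟩ => ⟨p₀, h₁, h₂, h₃.filter_mono h⟩)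
    fun h' φ hφ => (h' φ hφ).filter_mono h

/-- The filter `F` is generated by sets that depend only on the coordinates in `C`. -/
def SupportedOn {ι : Type*} {X : Type*} (F : Filter (ι → X)) (C : Set ι) : Prop :=
  ∀ S ∈ F, ∃ S' ∈ F, S' ⊆ S ∧ ∀ v w : ι → X, Set.EqOn v w C → v ∈ S' → w ∈ S'

theorem SupportedOn.mono {ι : Type*} {X : Type*} {F : Filter (ι → X)} {C D : Set ι}
    (h : SupportedOn F C) (hCD : C ⊆ D) : SupportedOn F D := fun S hS =>
  let ⟨S', h₁, h₂, h₃⟩ := h S hS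
  ⟨S', h₁, h₂, fun v w hvw => h₃ v w (hvw.mono hCD)⟩

theorem SupportedOn.inf {ι : Type*} {X : Type*} {F G : Filter (ι → X)} {C : Set ι}
    (hF : SupportedOn F C) (hG : SupportedOn G C) : SupportedOn (F ⊓ G) C := by
  intro S hS
  obtain ⟨S₁, h₁, S₂, h₂, rfl⟩ := Filter.mem_inf_iff.1 hS
  obtain ⟨T₁, a₁, b₁, c₁⟩ := hF S₁ h₁
  obtain ⟨T₂, a₂, b₂, c₂⟩ := hG S₂ h₂
  exact ⟨T₁ ∩ T₂, Filter.inter_mem_inf a₁ a₂, Set.inter_subset_inter b₁ b₂,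
    fun v w hvw hv => ⟨c₁ v w hvw hv.1, c₂ v w hvw hv.2⟩⟩

/-- A filter on the interpretations of the names that decides all types named by elements
of `C`. -/
structure Name.Approx (C : Set (Name L I)) (F : Filter (Name L I → M)) : Prop where
  neBot : F.NeBot
  supported : SupportedOn F C
  decided : ∀ f p, Name.mk f p ∈ C → Name.Decided F f p

/-- If `mk f p` lies outside `C`, a filter supported on `C` leaves that coordinate free. Either some
finite part of `p` is unsatisfiable on an `F`-positive set, and `F` is restricted to that set, or
every finite part is satisfiable almost everywhere, and the coordinate can be required to realize
`p`. -/
theorem Name.Approx.exists_insert {C : Set (Name L I)} {F : Filter (Name L I → M)}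
    (h : Name.Approx C F) {f : I → Name L I} (hf : ∀ i, f i ∈ C)
    (p : Set (L.Formula (I ⊕ Unit))) :
    ∃ G ≤ F, Name.Approx (insert (Name.mk f p) C) G := by
  classical
  by_cases hc : Name.mk f p ∈ C
  · exact ⟨F, le_rfl, by rwa [Set.insert_eq_of_mem hc]⟩
  have hcomp : ∀ {v w : Name L I → M}, Set.EqOn v w C → v ∘ f = w ∘ f := fun hvw =>
    funext fun i => hvw (hf i)
  suffices ∃ G : Filter (Name L I → M), (F ⊓ G).NeBot ∧
      SupportedOn G (insert (Name.mk f p) C) ∧ Name.Decided G f p by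
    obtain ⟨G, h₁, h₂, h₃⟩ := this
    refine ⟨F ⊓ G, inf_le_left, h₁, (h.supported.mono (Set.subset_insert _ _)).inf h₂, ?_⟩
    rintro g q (hgq | hgq)
    · rw [Name.mk.injEq] at hgq
      obtain ⟨rfl, rfl⟩ := hgq
      exact h₃.mono inf_le_right
    · exact (h.decided g q hgq).mono inf_le_left
  by_cases hp : ∃ p₀ ⊆ p, p₀.Finite ∧ (F ⊓ Filter.principal
      {v | ¬∃ x : M, ∀ φ ∈ p₀, φ.Realize (Sum.elim (v ∘ f) fun _ => x)}).NeBot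
  · obtain ⟨p₀, h₁, h₂, h₃⟩ := hp
    refine ⟨_, h₃, ?_, Or.inl ⟨p₀, h₁, h₂, Filter.mem_principal_self _⟩⟩
    intro S hS
    refine ⟨_, Filter.mem_principal_self _, hS, fun v w hvw hv => ?_⟩
    have := hcomp (hvw.mono (Set.subset_insert _ _))
    simpa only [Set.mem_ofPred_eq, this] using hv
  · let B : Set (L.Formula (I ⊕ Unit)) → Set (Name L I → M) := fun p₀ =>
      {v | ∀ φ ∈ p₀, φ.Realize (Sum.elim (v ∘ f) fun _ => v (.mk f p))}
    let G : Filter (Name L I → M) :=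
      { sets := {S | ∃ p₀ ⊆ p, p₀.Finite ∧ B p₀ ⊆ S}
        univ_sets := ⟨∅, Set.empty_subset _, Set.finite_empty, Set.subset_univ _⟩
        sets_of_superset := fun ⟨p₀, a, b, c⟩ hS => ⟨p₀, a, b, c.trans hS⟩
        inter_sets := fun ⟨p₀, a, b, c⟩ ⟨p₁, a', b', c'⟩ =>
          ⟨p₀ ∪ p₁, Set.union_subset a a', b.union b', Set.subset_inter
            (fun v hv => c fun φ hφ => hv φ (Or.inl hφ))
            (fun v hv => c' fun φ hφ => hv φ (Or.inr hφ))⟩ }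
    have hG : ∀ p₀ ⊆ p, p₀.Finite → B p₀ ∈ G := fun p₀ a b => ⟨p₀, a, b, subset_rfl⟩
    refine ⟨G, ?_, ?_, Or.inr fun φ hφ => ?_⟩
    · refine Filter.inf_neBot_iff.2 fun {S} hS {S'} hS' => ?_
      obtain ⟨p₀, a, b, c⟩ := hS'
      push Not at hp
      have hp₀ := hp p₀ a b
      rw [Filter.inf_principal_eq_bot] at hp₀
      -- `S₁` depends on the coordinates in `C` only, so resetting the coordinate `mk f p` to a
      -- witness `x` does not leave it.
      obtain ⟨S₁, h₁, h₂, h₃⟩ := h.supported S hS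
      have := h.neBot
      obtain ⟨v, hv, hv'⟩ := Filter.nonempty_of_mem (Filter.inter_mem h₁ hp₀)
      replace hv' : ¬∀ x : M, ∃ φ ∈ p₀, ¬φ.Realize (Sum.elim (v ∘ f) fun _ => x) := hv'
      push Not at hv'
      obtain ⟨x, hx⟩ := hv'
      have hvw : Set.EqOn v (Function.update v (Name.mk f p) x) C := fun y hy =>
        (Function.update_of_ne (ne_of_mem_of_not_mem hy hc) _ _).symm
      refine ⟨_, h₂ (h₃ v _ hvw hv), c fun φ hφ => ?_⟩
      rw [← hcomp hvw, Function.update_self]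
      exact hx φ hφ
    · rintro S ⟨p₀, a, b, c⟩
      refine ⟨B p₀, hG p₀ a b, c, fun v w hvw hv φ hφ => ?_⟩
      rw [← hcomp (hvw.mono (Set.subset_insert _ _)), ← hvw (Set.mem_insert _ _)]
      exact hv φ hφ
    · filter_upwards [hG {φ} (Set.singleton_subset_iff.2 hφ) (Set.finite_singleton _)] with v hv
      exact hv φ rfl

/-- Zorn's lemma is applied to pairs `(C, F)`, with `C` growing and `F` becoming finer. A maximal
`C` contains every name by induction on names: the induction hypothesis puts all `f i` in `C`,
exactly as `exists_insert` requires. Passing to an ultrafilter keeps all decisions. -/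
theorem Name.exists_ultrafilter (L : FirstOrder.Language.{u, v}) (I M : Type w) [L.Structure M]
    [Nonempty M] :
    ∃ U : Ultrafilter (Name L I → M), ∀ f p, Name.Decided (U : Filter (Name L I → M)) f p := by
  let s : Set (Set (Name L I) × (Filter (Name L I → M))ᵒᵈ) :=
    {x | Name.Approx x.1 (OrderDual.ofDual x.2)}
  have hbot : ((∅ : Set (Name L I)), OrderDual.toDual (⊤ : Filter (Name L I → M))) ∈ s :=
    ⟨show (⊤ : Filter (Name L I → M)).NeBot from inferInstance, fun S hS => ⟨S, hS, subset_rfl,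
      fun v w _ _ => by rw [Filter.mem_top.1 hS]; trivial⟩, fun f p h => h.elim⟩
  obtain ⟨⟨C, F⟩, -, hmax⟩ := zorn_le_nonempty₀ s (fun c hcs hc y hy => by
    have : Nonempty c := ⟨⟨y, hy⟩⟩
    let F : c → Filter (Name L I → M) := fun x => OrderDual.ofDual x.1.2
    have hdir : Directed (· ≥ ·) F := by
      intro x y
      rcases hc.total x.2 y.2 with h | h
      · exact ⟨y, h.2, le_rfl⟩
      · exact ⟨x, le_rfl, h.2⟩
    refine ⟨⟨⋃ x : c, x.1.1, OrderDual.toDual (⨅ x, F x)⟩, ⟨?_, ?_, ?_⟩, fun z hz =>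
      ⟨Set.subset_iUnion (fun x : c => x.1.1) ⟨z, hz⟩, iInf_le F ⟨z, hz⟩⟩⟩
    · have : ∀ x, (F x).NeBot := fun x => (hcs x.2).neBot
      exact Filter.iInf_neBot_of_directed' hdir this
    · intro S hS
      obtain ⟨x, hx⟩ := (Filter.mem_iInf_of_directed hdir S).1 hS
      obtain ⟨S', h₁, h₂, h₃⟩ := (hcs x.2).supported S hx
      exact ⟨S', Filter.mem_iInf_of_mem x h₁, h₂, fun v w hvw =>
        h₃ v w (hvw.mono (Set.subset_iUnion (fun x : c => x.1.1) x))⟩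
    · intro f p hfp
      obtain ⟨x, hx⟩ := Set.mem_iUnion.1 hfp
      exact ((hcs x.2).decided f p hx).mono (iInf_le F x)) _ hbot
  have hCF : Name.Approx C (OrderDual.ofDual F) := hmax.prop
  have hC : ∀ c, c ∈ C := by
    intro c
    induction c with
    | base =>
      have h : ((insert Name.base C : Set (Name L I)), F) ∈ s :=
        ⟨hCF.neBot, hCF.supported.mono (Set.subset_insert _ _), fun f p h =>
          hCF.decided f p (h.resolve_left (by simp))⟩
      exact (hmax.le_of_ge h ⟨Set.subset_insert _ _, le_rfl⟩).1 (Set.mem_insert _ _)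
    | mk f p ih =>
      obtain ⟨G, hG, h⟩ := hCF.exists_insert ih p
      have h : ((insert (Name.mk f p) C : Set (Name L I)), OrderDual.toDual G) ∈ s := h
      exact (hmax.le_of_ge h ⟨Set.subset_insert _ _, hG⟩).1 (Set.mem_insert _ _)
  have := hCF.neBot
  exact ⟨Ultrafilter.of (OrderDual.ofDual F), fun f p =>
    (hCF.decided f p (hC _)).mono (Ultrafilter.of_le _)⟩

variable (U : Ultrafilter (Name L I → M))

/-- The element of the ultrapower named by `c`. -/
def Name.eval (c : Name L I) : (U : Filter (Name L I → M)).Product fun _ => M :=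
  ((fun v => v c : (Name L I → M) → M) : (U : Filter (Name L I → M)).Product fun _ => M)

variable {U}

theorem Name.realize_eval [Nonempty M] {ι : Type*} (φ : L.Formula ι) (f : ι → Name L I) :
    φ.Realize (fun i => Name.eval U (f i)) ↔ ∀ᶠ v in (U : Filter (Name L I → M)), φ.Realize (v ∘ f) :=
  Ultraproduct.realize_formula_cast (M := fun _ : Name L I → M => M) φ fun i v => v (f i)

/-- By Łoś, a finite part of `p` satisfied in the ultrapower is satisfiable almost everywhere, which
rules out the first alternative of `Decided`. -/
theorem Name.realize_mk [Nonempty M] (hU : ∀ f p, Name.Decided (U : Filter (Name L I → M)) f p)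
    (f : I → Name L I) (p : Set (L.Formula (I ⊕ Unit)))
    (hp : ∀ p₀ ⊆ p, p₀.Finite → ∃ b : (U : Filter (Name L I → M)).Product fun _ => M,
      ∀ φ ∈ p₀, φ.Realize (Sum.elim (fun i => Name.eval U (f i)) fun _ => b)) :
    ∀ φ ∈ p, φ.Realize (Sum.elim (fun i => Name.eval U (f i))
      fun _ => Name.eval U (.mk f p)) := by
  rcases hU f p with ⟨p₀, h₁, h₂, h₃⟩ | h
  · exfalso
    obtain ⟨b, hb⟩ := hp p₀ h₁ h₂
    have : Finite p₀ := h₂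
    let χ : L.Formula I := Formula.iExs Unit (Formula.iInf fun φ : p₀ => φ.1)
    have hχ : χ.Realize fun i => Name.eval U (f i) := by
      simp only [χ, Formula.realize_iExs, Formula.realize_iInf]
      exact ⟨fun _ => b, fun φ => hb φ φ.2⟩
    rw [Name.realize_eval] at hχ
    obtain ⟨v, hv, hv'⟩ := (hχ.and h₃).exists
    simp only [χ, Formula.realize_iExs, Formula.realize_iInf] at hv
    obtain ⟨x, hx⟩ := hv
    exact hv' ⟨x (), fun φ hφ => hx ⟨φ, hφ⟩⟩
  · intro φ hφ
    have h' := (Name.realize_eval (U := U) φ (Sum.elim f fun _ => .mk f p)).2 <| by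
      filter_upwards [h φ hφ] with v hv
      convert hv using 1
      ext (i | i) <;> rfl
    convert h' using 1
    ext (i | i) <;> rfl

/-- The Tarski–Vaught criterion for the named elements, obtained from the type `{φ}`. Since `I` is
infinite, any finite tuple of names fits into one family `I → Name`; the unused slots hold `base`.
-/
theorem Name.exists_realize [Nonempty M] [Infinite I]
    (hU : ∀ f p, Name.Decided (U : Filter (Name L I → M)) f p) {n : ℕ} (φ : L.Formula (Fin n ⊕ Unit))
    (x : Fin n → Name L I) (a : (U : Filter (Name L I → M)).Product fun _ => M)
    (ha : φ.Realize (Sum.elim (fun i => Name.eval U (x i)) fun _ => a)) :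
    ∃ c : Name L I, φ.Realize (Sum.elim (fun i => Name.eval U (x i)) fun _ => Name.eval U c) := by
  let e : Fin n ↪ I := (Fin.valEmbedding).trans (Infinite.natEmbedding I)
  let f : I → Name L I := Function.extend e x fun _ => .base
  have key : ∀ b, ((φ.relabel (Sum.map e id)).Realize
      (Sum.elim (fun i => Name.eval U (f i)) fun _ => b) ↔
      φ.Realize (Sum.elim (fun i => Name.eval U (x i)) fun _ => b)) := by
    intro b
    rw [Formula.realize_relabel]
    have : (Sum.elim (fun i => Name.eval U (f i)) fun _ => b) ∘ Sum.map e id =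
        Sum.elim (fun i => Name.eval U (x i)) fun _ : Unit => b := by
      ext (i | i)
      · simp [f, e.injective.extend_apply]
      · rfl
    rw [this]
  refine ⟨_, (key _).1 (Name.realize_mk hU f {φ.relabel (Sum.map e id)}
    (fun p₀ h _ => ⟨a, ?_⟩) _ rfl)⟩
  intro χ hχ
  rw [h hχ]
  exact (key a).2 ha

/-- The elementary substructure of named elements. -/
def Name.range [Nonempty M] [Infinite I] (hU : ∀ f p, Name.Decided (U : Filter (Name L I → M)) f p) :
    L.ElementarySubstructure ((U : Filter (Name L I → M)).Product fun _ => M) :=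
  Substructure.toElementarySubstructure
    { carrier := Set.range (Name.eval U)
      fun_mem := by
        intro n g x hx
        choose y hy using hx
        obtain rfl : (fun i => Name.eval U (y i)) = x := funext hy
        obtain ⟨c, hc⟩ := Name.exists_realize hU
          ((Term.func g fun i => Term.var (Sum.inl i)).equal (Term.var (Sum.inr ()))) y
          (Structure.funMap g fun i => Name.eval U (y i)) (by simp [Formula.realize_equal])
        simp only [Formula.realize_equal, Term.realize_func, Term.realize_var, Sum.elim_inl,
          Sum.elim_inr] at hc
        exact ⟨c, hc.symm⟩ }
    (by
      intro n φ x a ha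
      choose y hy using fun i => (x i).2
      have key : ∀ b, (φ.toFormula.relabel (Sum.elim Empty.elim
          (Fin.lastCases (Sum.inr ()) Sum.inl) : Empty ⊕ Fin (n + 1) → Fin n ⊕ Unit)).Realize
          (Sum.elim (fun i => Name.eval U (y i)) fun _ => b) ↔
          φ.Realize default (Fin.snoc (fun i => ((x i : _) :
            (U : Filter (Name L I → M)).Product fun _ => M)) b :
              Fin (n + 1) → (U : Filter (Name L I → M)).Product fun _ => M) := by
        intro b
        rw [Formula.realize_relabel, BoundedFormula.realize_toFormula]
        apply iff_of_eq
        congr 1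
        · exact Subsingleton.elim _ _
        · ext i
          refine Fin.lastCases ?_ (fun i => ?_) i <;> simp [hy]
      obtain ⟨c, hc⟩ := Name.exists_realize hU _ y a ((key a).2 ha)
      exact ⟨⟨_, c, rfl⟩, (key _).1 hc⟩)

/-- All of `C` is named by a single family `f : I → Name`, so `mk f p` already names a realization.
No chain of extensions is needed. -/
theorem Name.isSaturated_range [Nonempty M] [Infinite I]
    (hU : ∀ f p, Name.Decided (U : Filter (Name L I → M)) f p) {C : Set (Name.range hU)} (e : C ↪ I)
    (p : Set (L.Formula (C ⊕ Unit))) (hp : FinSat L p) :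
    ∃ b : Name.range hU, ∀ φ ∈ p, HoldsAt L φ b := by
  have hx : ∀ c : Name.range hU, ∃ x, Name.eval U x = c := fun c => c.2
  choose g hg using hx
  let f : I → Name L I := Function.extend e (fun c => g c) fun _ => .base
  have key : ∀ (φ : L.Formula (C ⊕ Unit)) (b : Name.range hU),
      (φ.relabel (Sum.map e id)).Realize (Sum.elim (fun i => Name.eval U (f i)) fun _ => b) ↔
        HoldsAt L φ b := by
    intro φ b
    rw [HoldsAt, Formula.realize_relabel, ← (Name.range hU).subtype.map_formula]
    have : (Sum.elim (fun i => Name.eval U (f i)) fun _ => (b : _)) ∘ Sum.map e id =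
        (Name.range hU).subtype ∘ (Sum.elim (fun c : C => (c : Name.range hU)) fun _ : Unit => b) := by
      ext (i | i)
      · simp [f, e.injective.extend_apply, hg]
      · rfl
    rw [this]
  have := Name.realize_mk hU f ((fun φ => φ.relabel (Sum.map e id)) '' p) (by
    intro p₀ h₁ h₂
    obtain ⟨p₁, h₃, h₄, rfl⟩ := Set.exists_subset_image_finite_and.1 ⟨p₀, h₁, h₂, rfl⟩
    obtain ⟨b, hb⟩ := hp p₁ h₃ h₄
    refine ⟨b, ?_⟩
    rintro _ ⟨φ, hφ, rfl⟩
    exact (key φ b).2 (hb φ hφ))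
  exact ⟨⟨_, _, rfl⟩, fun φ hφ => (key φ _).1 (this _ ⟨φ, hφ, rfl⟩)⟩

end Saturation

/-- With `I` of cardinality `κ`, every parameter set smaller than the successor of `κ` embeds into
`I`, whatever the size of the language. -/
theorem exists_isSaturated (L : FirstOrder.Language.{u, v}) (M : Type max u v) [L.Structure M]
    [Nonempty M] (κ : Cardinal.{max u v}) (hκ : ℵ₀ ≤ κ) :
    ∃ (N : Type max u v) (_ : L.Structure N), Nonempty N ∧ (M ≅[L] N) ∧
      IsSaturated L N (Order.succ κ) := by
  have : Infinite κ.out := by rwa [Cardinal.infinite_iff, Cardinal.mk_out]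
  obtain ⟨U, hU⟩ := Name.exists_ultrafilter L κ.out M
  refine ⟨Name.range hU, inferInstance, ⟨⟨_, .base, rfl⟩⟩, ?_, ?_⟩
  · refine ElementarilyEquivalent.trans ?_ (Name.range hU).elementarilyEquivalent.symm
    rw [elementarilyEquivalent_iff]
    intro φ
    rw [Ultraproduct.sentence_realize]
    simp
  · intro C hC p hp
    obtain ⟨e⟩ := Cardinal.le_def _ _ |>.1 ((Order.lt_succ_iff.1 hC).trans (Cardinal.mk_out κ).ge)
    exact Name.isSaturated_range hU e p hp

/-! ## Tuples of the same type, algebraic closure and independence -/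

section Types

variable (L : FirstOrder.Language.{u, v}) {ι ι' M N : Type*} [L.Structure M] [L.Structure N]

/-- The tuples `c` and `d` have the same type. -/
def SameType (c : ι → M) (d : ι → N) : Prop :=
  ∀ φ : L.Formula ι, φ.Realize c ↔ φ.Realize d

variable {L} {c : ι → M} {d : ι → N}

theorem SameType.symm (h : SameType L c d) : SameType L d c := fun φ => (h φ).symm

theorem SameType.of_imp (h : ∀ φ : L.Formula ι, φ.Realize c → φ.Realize d) : SameType L c d :=
  fun φ => ⟨h φ, fun hd => by_contra fun hc => (h φ.not hc) hd⟩

theorem SameType.comp (h : SameType L c d) (g : ι' → ι) : SameType L (c ∘ g) (d ∘ g) := fun φ => by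
  simpa only [Formula.realize_relabel] using h (φ.relabel g)

theorem SameType.eq_iff (h : SameType L c d) (i j : ι) : c i = c j ↔ d i = d j := by
  simpa [Formula.realize_equal] using h ((Term.var i).equal (Term.var j))

theorem SameType.exists_iff (h : SameType L c d) (φ : L.Formula (ι ⊕ Unit)) :
    (∃ y, φ.Realize (Sum.elim c fun _ => y)) ↔ ∃ y, φ.Realize (Sum.elim d fun _ => y) := by
  have := h (Formula.iExs Unit φ)
  simp only [Formula.realize_iExs] at this
  constructor <;> rintro ⟨y, hy⟩
  · obtain ⟨z, hz⟩ := this.1 ⟨fun _ => y, hy⟩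
    exact ⟨z (), hz⟩
  · obtain ⟨z, hz⟩ := this.2 ⟨fun _ => y, hy⟩
    exact ⟨z (), hz⟩

theorem realize_relabel_sumMap (φ : L.Formula (ι' ⊕ Unit)) (g : ι' → ι) (c : ι → M) (f : Unit → M) :
    (φ.relabel (Sum.map g id)).Realize (Sum.elim c f) ↔ φ.Realize (Sum.elim (c ∘ g) f) := by
  rw [Formula.realize_relabel, Sum.elim_comp_map, Function.comp_id]

/-- The formula saying that there are `n` elements among which are all solutions of `φ`. -/
noncomputable def coveredBy (φ : L.Formula (ι ⊕ Unit)) (n : ℕ) : L.Formula ι :=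
  Formula.iExs (Fin n) (Formula.iAlls Unit
    ((φ.relabel (Sum.map Sum.inl id)).imp
      (Formula.iSup fun i : Fin n => (Term.var (Sum.inr ())).equal (Term.var (Sum.inl (Sum.inr i))))))

theorem realize_coveredBy (φ : L.Formula (ι ⊕ Unit)) (n : ℕ) (c : ι → M) :
    (coveredBy φ n).Realize c ↔
      ∃ z : Fin n → M, ∀ y, φ.Realize (Sum.elim c fun _ => y) → ∃ i, y = z i := by
  simp only [coveredBy, Formula.realize_iExs, Formula.realize_iAlls, Formula.realize_imp,
    realize_relabel_sumMap, Formula.realize_iSup, Formula.realize_equal, Term.realize_var,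
    Sum.elim_inl, Sum.elim_inr, Sum.elim_comp_inl]
  exact exists_congr fun z => ⟨fun h y hy => h (fun _ => y) hy, fun h y hy => h (y ()) hy⟩

theorem finite_of_realize_coveredBy {φ : L.Formula (ι ⊕ Unit)} {n : ℕ} {c : ι → M}
    (h : (coveredBy φ n).Realize c) : {y | φ.Realize (Sum.elim c fun _ => y)}.Finite := by
  obtain ⟨z, hz⟩ := (realize_coveredBy φ n c).1 h
  exact (Set.finite_range z).subset fun y hy => let ⟨i, hi⟩ := hz y hy; ⟨i, hi.symm⟩

theorem exists_realize_coveredBy {φ : L.Formula (ι ⊕ Unit)} {c : ι → M}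
    (h : {y | φ.Realize (Sum.elim c fun _ => y)}.Finite) : ∃ n, (coveredBy φ n).Realize c := by
  obtain ⟨n, f, -, hf⟩ := h.fin_param
  exact ⟨n, (realize_coveredBy φ n c).2 ⟨f, fun y hy => by
    have : y ∈ Set.range f := hf ▸ hy
    exact this.imp fun i hi => hi.symm⟩⟩

/-- Finiteness is not expressed by one formula, but it is the disjunction over `n` of the formulas
`coveredBy φ n`, hence a property of the type. -/
theorem SameType.finite_iff (h : SameType L c d) (φ : L.Formula (ι ⊕ Unit)) :
    {y | φ.Realize (Sum.elim c fun _ => y)}.Finite ↔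
      {y | φ.Realize (Sum.elim d fun _ => y)}.Finite :=
  ⟨fun hf => let ⟨n, hn⟩ := exists_realize_coveredBy hf
    finite_of_realize_coveredBy ((h (coveredBy φ n)).1 hn),
  fun hf => let ⟨n, hn⟩ := exists_realize_coveredBy hf
    finite_of_realize_coveredBy ((h (coveredBy φ n)).2 hn)⟩

theorem mem_acl_range (c : ι → M) (b : M) :
    b ∈ acl L (Set.range c) ↔ ∃ φ : L.Formula (ι ⊕ Unit),
      {y | φ.Realize (Sum.elim c fun _ => y)}.Finite ∧ φ.Realize (Sum.elim c fun _ => b) := by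
  constructor
  · rintro ⟨φ, h₁, h₂⟩
    choose g hg using fun x : Set.range c => x.2
    have hcg : c ∘ g = fun x : Set.range c => (x : M) := funext hg
    refine ⟨φ.relabel (Sum.map g id), ?_, ?_⟩
    · simpa only [realize_relabel_sumMap, hcg, HoldsAt] using h₁
    · simpa only [realize_relabel_sumMap, hcg, HoldsAt] using h₂
  · rintro ⟨φ, h₁, h₂⟩
    have key : ∀ y, HoldsAt L (φ.relabel (Sum.map (Set.rangeFactorization c) id)) y ↔
        φ.Realize (Sum.elim c fun _ => y) := fun y => realize_relabel_sumMap _ _ _ _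
    exact ⟨φ.relabel (Sum.map (Set.rangeFactorization c) id), by simpa only [key] using h₁,
      (key b).2 h₂⟩

theorem mem_acl_image (c : ι → M) (s : Set ι) (b : M) :
    b ∈ acl L (c '' s) ↔ ∃ φ : L.Formula (s ⊕ Unit),
      {y | φ.Realize (Sum.elim (fun i : s => c i) fun _ => y)}.Finite ∧
        φ.Realize (Sum.elim (fun i : s => c i) fun _ => b) := by
  rw [← mem_acl_range, Set.image_eq_range]

theorem SameType.mem_acl_image (h : SameType L c d) {s : Set ι} {i : ι}
    (hi : c i ∈ acl L (c '' s)) : d i ∈ acl L (d '' s) := by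
  rw [MLPair.mem_acl_image] at hi ⊢
  obtain ⟨φ, h₁, h₂⟩ := hi
  refine ⟨φ, ((h.comp (fun j : s => (j : ι))).finite_iff φ).1 h₁, ?_⟩
  have := h.comp (Sum.elim (fun j : s => (j : ι)) fun _ : Unit => i) φ
  simp only [Sum.comp_elim] at this
  exact this.1 h₂

end Types

theorem IsSaturated.exists_realize {L : FirstOrder.Language.{u, v}} {N : Type w} [L.Structure N]
    {κ : Cardinal.{w}} (h : IsSaturated L N κ) {ι : Type w} (hι : #ι < κ) (c : ι → N)
    (p : Set (L.Formula (ι ⊕ Unit)))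
    (hp : ∀ p₀ ⊆ p, p₀.Finite → ∃ b : N, ∀ φ ∈ p₀, φ.Realize (Sum.elim c fun _ => b)) :
    ∃ b : N, ∀ φ ∈ p, φ.Realize (Sum.elim c fun _ => b) := by
  have key : ∀ (φ : L.Formula (ι ⊕ Unit)) y,
      HoldsAt L (φ.relabel (Sum.map (Set.rangeFactorization c) id)) y ↔
        φ.Realize (Sum.elim c fun _ => y) := fun φ y => realize_relabel_sumMap _ _ _ _
  obtain ⟨b, hb⟩ := h (Set.range c) (Cardinal.mk_range_le.trans_lt hι)
    ((fun φ => φ.relabel (Sum.map (Set.rangeFactorization c) id)) '' p) (by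
      intro p₀ h₁ h₂
      obtain ⟨p₁, h₃, h₄, rfl⟩ := Set.exists_subset_image_finite_and.1 ⟨p₀, h₁, h₂, rfl⟩
      obtain ⟨b, hb⟩ := hp p₁ h₃ h₄
      refine ⟨b, ?_⟩
      rintro _ ⟨φ, hφ, rfl⟩
      exact (key φ b).2 (hb φ hφ))
  exact ⟨b, fun φ hφ => (key φ b).1 (hb _ ⟨φ, hφ, rfl⟩)⟩

/-! ### Independence in a pregeometry -/

section Pregeometry

variable {L : FirstOrder.Language.{u, v}} {N : Type w} [L.Structure N]

theorem IsPregeometry.cl_subset_of_subset_cl {X : Type w} {cl : Set X → Set X}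
    (h : IsPregeometry cl) {C D : Set X} (hCD : C ⊆ cl D) : cl C ⊆ cl D :=
  (h.mono _ _ hCD).trans (h.cl_cl D).subset

theorem AclIndep.subset (h : IsPregeometry (acl L (N := N))) {X Y Z : Set N} (hX : AclIndep L X Z)
    (hYX : Y ⊆ X) : AclIndep L Y Z := fun x hx hx' =>
  hX x (hYX hx) (h.mono _ _ (Set.union_subset_union_right _ (Set.sdiff_subset_sdiff_left hYX)) hx')

theorem AclIndep.insert_of_notMem (h : IsPregeometry (acl L (N := N))) {X Z : Set N} (hX : AclIndep L X Z)
    {b : N} (hb : b ∉ acl L (Z ∪ X)) : AclIndep L (insert b X) Z := by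
  rintro x (rfl | hx) hx'
  · exact hb (h.mono _ _ (Set.union_subset_union_right _ (by simp)) hx')
  · have h₁ : x ∈ acl L (insert b (Z ∪ (X \ {x}))) := h.mono _ _ (by
      rintro y (hy | ⟨hy | hy, hyx⟩)
      · exact Or.inr (Or.inl hy)
      · exact Or.inl hy
      · exact Or.inr (Or.inr ⟨hy, hyx⟩)) hx'
    refine hb (h.mono _ _ ?_ (h.exchange _ _ _ h₁ (hX x hx)))
    rintro y (rfl | hy | hy)
    exacts [Or.inr hx, Or.inl hy, Or.inr hy.1]

/-- Steinitz exchange, by induction on the number of elements of `S` missing from `X`: elements of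
`S` are added to `X` or swapped for elements of `X` until `X ⊆ S`. -/
theorem AclIndep.of_subset_acl (h : IsPregeometry (acl L (N := N))) {X S Y Z : Set N}
    (hS : S.Finite) (hSY : AclIndep L S Y) (hZY : Z ⊆ Y) (hX : X ⊆ acl L (S ∪ Z))
    (hXZ : AclIndep L X Z) : AclIndep L X Y := by
  induction hn : (S \ X).ncard using Nat.strong_induction_on generalizing X with
  | _ n ih =>
    subst hn
    have hlt : ∀ {X' : Set N} {c}, c ∈ S → c ∉ X → c ∈ X' → S ∩ X ⊆ X' →
        (S \ X').ncard < (S \ X).ncard := by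
      intro X' c hcS hcX hcX' hSX
      refine Set.ncard_lt_ncard ⟨fun y hy => ⟨hy.1, fun hyX => hy.2 (hSX ⟨hy.1, hyX⟩)⟩, fun hc => ?_⟩
        (hS.subset Set.sdiff_subset)
      exact (hc ⟨hcS, hcX⟩).2 hcX'
    by_cases hex : ∃ c ∈ S, c ∉ acl L (Z ∪ X)
    · obtain ⟨c, hcS, hc⟩ := hex
      have hcX : c ∉ X := fun hcX => hc (h.subset_cl _ (Or.inr hcX))
      refine (ih _ (hlt hcS hcX (Set.mem_insert c X) fun y hy => Or.inr hy.2)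
        (Set.insert_subset (h.subset_cl _ (Or.inl hcS)) hX) (hXZ.insert_of_notMem h hc) rfl).subset h
        (Set.subset_insert _ _)
    push Not at hex
    -- From here on `S ⊆ acl (Z ∪ X)`, so nothing from `S` can be added to `X`; an element `x` of
    -- `X` outside `S` is exchanged for some `c ∈ S`.
    by_cases hXS : X ⊆ S
    · exact hSY.subset h hXS
    obtain ⟨x, hxX, hxS⟩ := Set.not_subset.1 hXS
    have hc : ∃ c ∈ S, c ∉ acl L (Z ∪ (X \ {x})) := by
      by_contra! hc
      refine hXZ x hxX (h.cl_subset_of_subset_cl (Set.union_subset hc fun z hz => ?_) (hX hxX))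
      exact h.subset_cl _ (Or.inl hz)
    obtain ⟨c, hcS, hc⟩ := hc
    have hxc : x ≠ c := fun e => hxS (e ▸ hcS)
    have hcX : c ∉ X := fun hcX => hc (h.subset_cl _ (Or.inr ⟨hcX, hxc.symm⟩))
    have hI : AclIndep L (insert c (X \ {x})) Y :=
      ih _ (hlt (X' := insert c (X \ {x})) hcS hcX (Set.mem_insert c _) fun y hy =>
        Or.inr ⟨hy.2, fun e => hxS (e ▸ hy.1)⟩)
        (Set.insert_subset (h.subset_cl _ (Or.inl hcS)) (Set.sdiff_subset.trans hX))
        ((hXZ.subset h Set.sdiff_subset).insert_of_notMem h hc) rfl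
    -- Restoring `x`: if it were algebraic over `Y ∪ (X \ {x})`, so would be `c`, which lies in `acl
    -- (Z ∪ X)`, against the independence `hI`.
    have hx : x ∉ acl L (Y ∪ (X \ {x})) := by
      intro hx
      refine hI c (Set.mem_insert _ _) (h.mono (Y ∪ (X \ {x})) _ ?_ ?_)
      · exact Set.union_subset_union_right _ fun y hy =>
          ⟨Or.inr hy, fun e => hcX (e ▸ hy.1)⟩
      · refine h.cl_subset_of_subset_cl ?_ (hex c hcS)
        rintro y (hy | hy)
        · exact h.subset_cl _ (Or.inl (hZY hy))
        · by_cases hyx : y = x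
          · exact hyx ▸ hx
          · exact h.subset_cl _ (Or.inr ⟨hy, hyx⟩)
    have := (hI.subset h (Set.subset_insert _ _)).insert_of_notMem h hx
    rwa [Set.insert_sdiff_singleton, Set.insert_eq_of_mem hxX] at this

/-- If `X` is algebraic over `S ∪ Z` with `S` finite and independent over `Y ⊇ Z`, then `X` is
independent from `Y` over `Z`. -/
theorem indepOver_of_subset_acl (h : IsPregeometry (acl L (N := N))) {X S Y Z : Set N}
    (hS : S.Finite) (hSY : AclIndep L S Y) (hZY : Z ⊆ Y) (hX : X ⊆ acl L (S ∪ Z)) :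
    IndepOver L X Y Z := fun X₀ hX₀ hi => by
  rw [Set.union_eq_self_of_subset_right hZY]
  exact AclIndep.of_subset_acl h hS hSY hZY (Set.Subset.trans hX₀ hX) hi

end Pregeometry

/-! ### Partial elementary relations -/

section PartialElementary

variable (L : FirstOrder.Language.{u, v}) {M N : Type*} [L.Structure M] [L.Structure N]

/-- The relation `P` between `M` and `N` preserves all formulas in both directions. -/
def PartialElem (P : Set (M × N)) : Prop :=
  SameType L (fun x : P => x.1.1) fun x : P => x.1.2

variable {L} {P Q : Set (M × N)}

theorem PartialElem.sameType (h : PartialElem L P) {ι : Type*} (x : ι → M × N)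
    (hx : ∀ i, x i ∈ P) : SameType L (fun i => (x i).1) fun i => (x i).2 :=
  SameType.comp h fun i => ⟨x i, hx i⟩

theorem PartialElem.swap (h : PartialElem L P) : PartialElem L (Prod.swap ⁻¹' P) := by
  have h' : SameType L (fun x : P => x.1.2) fun x : P => x.1.1 := SameType.symm h
  exact h'.comp fun x : Prod.swap ⁻¹' P => (⟨x.1.swap, x.2⟩ : P)

theorem PartialElem.insert_of_imp {a : M} {b : N}
    (h : ∀ φ : L.Formula (P ⊕ Unit), φ.Realize (Sum.elim (fun x : P => x.1.1) fun _ => a) →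
      φ.Realize (Sum.elim (fun x : P => x.1.2) fun _ => b)) :
    PartialElem L (insert (a, b) P) := by
  classical
  have hs := SameType.of_imp h
  -- The pair `(a, b)` may already belong to `P`; then it is treated as an old element.
  let g : ↥(insert (a, b) P : Set (M × N)) → P ⊕ Unit := fun x =>
    if hx : x.1 ∈ P then Sum.inl ⟨x.1, hx⟩ else Sum.inr ()
  have h₁ : Sum.elim (fun x : P => x.1.1) (fun _ => a) ∘ g = fun x => x.1.1 := by
    ext ⟨x, hx⟩
    by_cases hxP : x ∈ P
    · simp [g, hxP]
    · obtain rfl := hx.resolve_right hxP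
      simp [g, hxP]
  have h₂ : Sum.elim (fun x : P => x.1.2) (fun _ => b) ∘ g = fun x => x.1.2 := by
    ext ⟨x, hx⟩
    by_cases hxP : x ∈ P
    · simp [g, hxP]
    · obtain rfl := hx.resolve_right hxP
      simp [g, hxP]
  have := hs.comp g
  rwa [h₁, h₂] at this

/-- Equality is a formula, so `P` is the graph of an injective partial map. -/
theorem PartialElem.fst_eq_iff (h : PartialElem L P) {x y : M × N} (hx : x ∈ P) (hy : y ∈ P) :
    x.1 = y.1 ↔ x.2 = y.2 :=
  SameType.eq_iff h ⟨x, hx⟩ ⟨y, hy⟩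

theorem PartialElem.mem_acl (h : PartialElem L P) (hQ : Q ⊆ P) {x : M × N} (hx : x ∈ P)
    (ha : x.1 ∈ acl L (Prod.fst '' Q)) : x.2 ∈ acl L (Prod.snd '' Q) := by
  have key := SameType.mem_acl_image h (s := Subtype.val ⁻¹' Q) (i := ⟨x, hx⟩)
  have h₁ : (fun x : P => x.1.1) '' (Subtype.val ⁻¹' Q) = Prod.fst '' Q := by
    change (Prod.fst ∘ Subtype.val) '' _ = _
    rw [Set.image_comp, Subtype.image_preimage_coe, Set.inter_eq_self_of_subset_right hQ]
  have h₂ : (fun x : P => x.1.2) '' (Subtype.val ⁻¹' Q) = Prod.snd '' Q := by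
    change (Prod.snd ∘ Subtype.val) '' _ = _
    rw [Set.image_comp, Subtype.image_preimage_coe, Set.inter_eq_self_of_subset_right hQ]
  rw [h₁, h₂] at key
  exact key ha

end PartialElementary

/-! ## Basic properties of pairs -/

section Pairs

variable {L K : FirstOrder.Language.{u, v}} {R : ℕ → Type v}
  {Tα : (langA L R).Theory} {Tβ : (langB L K).Theory}

instance (M : Pair Tα Tβ) : (inclBPair : langB L K →ᴸ langPair L K R).IsExpansionOn M :=
  LHom.isExpansionOn_reduct _ _

instance (M : Pair Tα Tβ) : (inclAPair : langA L R →ᴸ langPair L K R).IsExpansionOn M :=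
  LHom.isExpansionOn_reduct _ _

theorem mem_setA_iff {M : Pair Tα Tβ} {a : M} :
    a ∈ setA M ↔ Structure.RelMap (symbA : (langPair L K R).Relations 1) ![a] :=
  Iff.rfl

theorem realize_relativize (M : Pair Tα Tβ) {ι : Type w} {n : ℕ}
    (θ : (langA L R).BoundedFormula ι n) (v : ι → small M) (x : Fin n → small M) :
    (relativize (K := K) θ).Realize (fun i => (v i : M)) (fun i => (x i : M)) ↔
      θ.Realize v x := by
  have hterm : ∀ {n : ℕ} (t : (langA L R).Term (ι ⊕ Fin n)) (x : Fin n → small M),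
      ((inclAPair : langA L R →ᴸ langPair L K R).onTerm t).realize
        (Sum.elim (fun i => (v i : M)) fun i => (x i : M)) =
        ((t.realize (Sum.elim v x) : small M) : M) := by
    intro n t x
    rw [LHom.realize_onTerm, ← realize_term_substructure]
    congr 1
    ext (i | i) <;> rfl
  induction θ with
  | falsum => rfl
  | equal t₁ t₂ =>
    change _ = _ ↔ _ = _
    rw [hterm, hterm, Subtype.coe_inj]
  | rel r ts =>
    change Structure.RelMap _ (fun i => _) ↔ Structure.RelMap _ _
    simp only [hterm]
    rfl
  | imp θ₁ θ₂ ih₁ ih₂ =>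
    rw [relativize, BoundedFormula.realize_imp, BoundedFormula.realize_imp]
    exact imp_congr (ih₁ x) (ih₂ x)
  | all θ ih =>
    rw [relativize, BoundedFormula.realize_all, BoundedFormula.realize_all]
    have hs : ∀ a : small M, (Fin.snoc (fun i => (x i : M)) (a : M) : Fin (_ + 1) → M) =
        fun i => ((Fin.snoc x a : Fin (_ + 1) → small M) i : M) := by
      intro a
      ext i
      refine Fin.lastCases ?_ (fun i => ?_) i <;> simp
    constructor
    · intro h a
      have := h a
      rw [BoundedFormula.realize_imp, BoundedFormula.realize_rel₁] at this
      refine (ih _).1 ?_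
      rw [← hs]
      have ha : (a : M) ∈ setA M := a.2
      exact this (by simpa [← mem_setA_iff] using ha)
    · intro h a
      rw [BoundedFormula.realize_imp, BoundedFormula.realize_rel₁]
      intro ha
      have ha : a ∈ setA M := by simpa [← mem_setA_iff] using ha
      have := (ih _).2 (h ⟨a, ha⟩)
      rwa [← hs] at this

theorem realize_relativize_formula (M : Pair Tα Tβ) {ι : Type w} (θ : (langA L R).Formula ι)
    (v : ι → small M) :
    Formula.Realize (relativize (K := K) θ) (fun i => (v i : M)) ↔ θ.Realize v := by
  rw [Formula.Realize, Formula.Realize, ← realize_relativize]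
  exact iff_of_eq (congrArg _ (Subsingleton.elim _ _))

theorem realize_relativize_sentence (M : Pair Tα Tβ) (θ : (langA L R).Sentence) :
    (M : Type _) ⊨ (relativize θ : (langPair L K R).Sentence) ↔ small M ⊨ θ := by
  rw [Sentence.Realize, Sentence.Realize, ← realize_relativize_formula]
  exact iff_of_eq (congrArg _ (Subsingleton.elim _ _))

/-- The sentence `∃ x, ⊤` is valid in nonempty structures, so its relativization is an axiom of
`T²`. -/
theorem setA_nonempty (M : Pair Tα Tβ) : (setA M).Nonempty := by
  have hT : Tα ⊨ᵇ (∃' (⊤ : (langA L R).BoundedFormula Empty 1) : (langA L R).Sentence) := by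
    rw [Theory.models_sentence_iff]
    intro N
    have := N.nonempty'
    simp [Sentence.Realize, Formula.Realize]
  have h : (M : Type _) ⊨ (relativize (∃' (⊤ : (langA L R).BoundedFormula Empty 1)) :
      (langPair L K R).Sentence) :=
    Theory.realize_sentence_of_mem (pairTheory Tα Tβ) (Or.inl (Or.inl (Or.inr ⟨_, hT, rfl⟩)))
  by_contra hne
  rw [Set.not_nonempty_iff_eq_empty] at hne
  refine h fun a ha => ?_
  rw [BoundedFormula.realize_rel₁] at ha
  have : a ∈ setA M := by simpa [← mem_setA_iff, Fin.snoc] using ha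
  rw [hne] at this
  exact this.elim

instance (M : Pair Tα Tβ) : Nonempty (small M) := (setA_nonempty M).to_subtype

instance (M : Pair Tα Tβ) : small M ⊨ Tα :=
  ⟨fun φ hφ => (realize_relativize_sentence M φ).1
    (Theory.realize_sentence_of_mem (pairTheory Tα Tβ)
      (Or.inl (Or.inl (Or.inr ⟨φ, Theory.models_sentence_of_mem hφ, rfl⟩))))⟩

instance (M : Pair Tα Tβ) : (M : Type _) ⊨ Tβ :=
  ⟨fun φ hφ => (LHom.realize_onSentence M inclBPair φ).1
    (Theory.realize_sentence_of_mem (pairTheory Tα Tβ) (Or.inl (Or.inl (Or.inl ⟨φ, hφ, rfl⟩))))⟩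

theorem IsGeometric.isPregeometry (h : IsGeometric Tβ) (M : Pair Tα Tβ) :
    IsPregeometry (acl (langB L K) (N := M)) :=
  h.pregeometry (Theory.ModelType.of Tβ M)

theorem mem_setA_of_relMap (M : Pair Tα Tβ) {n : ℕ} (r : R n) (x : Fin n → M)
    (h : Structure.RelMap (symbR r : (langPair L K R).Relations n) x) (i : Fin n) :
    x i ∈ setA M := by
  have h₁ : (M : Type _) ⊨ (supportAxiom r : (langPair L K R).Sentence) :=
    Theory.realize_sentence_of_mem (pairTheory Tα Tβ) (Or.inr ⟨n, r, rfl⟩)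
  have h₂ := BoundedFormula.realize_alls.1 h₁ x
  rw [BoundedFormula.realize_imp, realize_allInA] at h₂
  exact h₂ h i

theorem realize_inclA_term (M : Pair Tα Tβ) {ι : Type w} (t : L.Term ι) (v : ι → small M) :
    ((((inclA : L →ᴸ langA L R).onTerm t).realize v : small M) : M) =
      ((inclB : L →ᴸ langB L K).onTerm t).realize fun i => (v i : M) := by
  induction t with
  | var => rfl
  | func f ts ih =>
    change Structure.funMap ((inclB : L →ᴸ langB L K).onFunction f)
      (fun i => ((((inclA : L →ᴸ langA L R).onTerm (ts i)).realize v : small M) : M)) = _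
    rw [funext ih]
    rfl

/-- `𝒜` and `ℬ` interpret the common language alike on `A`; only quantifiers could see the
difference. This verifies the compatibility hypothesis of `Density`. -/
theorem realize_inclA_iff (M : Pair Tα Tβ) {ι : Type w} {n : ℕ} {χ : L.BoundedFormula ι n}
    (hχ : χ.IsQF) (v : ι → small M) (x : Fin n → small M) :
    ((inclA : L →ᴸ langA L R).onBoundedFormula χ).Realize v x ↔
      ((inclB : L →ᴸ langB L K).onBoundedFormula χ).Realize
        (fun i => (v i : M)) fun i => (x i : M) := by
  have hv : (fun i => ((Sum.elim v x i : small M) : M)) =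
      Sum.elim (fun i => (v i : M)) fun i => (x i : M) := by
    ext (i | i) <;> rfl
  induction hχ with
  | falsum => rfl
  | of_isAtomic h =>
    cases h with
    | equal t₁ t₂ =>
      change _ = _ ↔ _ = _
      rw [← Subtype.coe_inj, realize_inclA_term, realize_inclA_term, hv]
    | rel r ts =>
      change Structure.RelMap ((inclB : L →ᴸ langB L K).onRelation r)
        (fun i => ((((inclA : L →ᴸ langA L R).onTerm (ts i)).realize (Sum.elim v x) : small M) : M)) ↔ _
      simp only [realize_inclA_term, hv]
      rfl
  | imp _ _ ih₁ ih₂ =>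
    change (_ → _) ↔ (_ → _)
    exact imp_congr ih₁ ih₂

theorem realize_inclA_formula (M : Pair Tα Tβ) {ι : Type w} {χ : L.Formula ι}
    (hχ : χ.IsQF) (v : ι → small M) :
    ((inclA : L →ᴸ langA L R).onFormula χ).Realize v ↔
      ((inclB : L →ᴸ langB L K).onFormula χ).Realize fun i => (v i : M) := by
  refine (realize_inclA_iff M hχ v default).trans ?_
  exact iff_of_eq (congrArg _ (Subsingleton.elim _ _))

theorem inType_typeOf {L' : FirstOrder.Language.{u, v}} (T : L'.Theory) {N : Type*}
    [L'.Structure N] [Nonempty N] [N ⊨ T] {ι : Type} (c : ι → N) (φ : L'.Formula ι) :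
    InType (T.typeOf c) φ ↔ φ.Realize c :=
  Theory.CompleteType.formula_mem_typeOf

/-- The Mordell-Lang condition for a pair of contenders. -/
theorem MordellLangCondition.exists_solution {T : (langPair L K R).Theory}
    (hT : MordellLangCondition Tα Tβ T) {M M' : Pair Tα Tβ} (hM : (M : Type _) ⊨ T)
    (hM' : (M' : Type _) ⊨ T) {n : ℕ} (c : Fin n → M) (c' : Fin n → M') (S : Set (Fin n))
    (hS : ∀ i, i ∈ S ↔ c i ∈ setA M) (hS' : ∀ i, i ∈ S ↔ c' i ∈ setA M')
    (hβ : SameType (langB L K) c c')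
    (hα : SameType (langA L R) (fun i : S => (⟨c i, (hS i).1 i.2⟩ : small M))
      fun i : S => (⟨c' i, (hS' i).1 i.2⟩ : small M'))
    (hi : IndepOver (langB L K) (Set.range c) (setA M) (c '' S))
    (hi' : IndepOver (langB L K) (Set.range c') (setA M') (c' '' S))
    (φ : (langB L K).Formula (Fin n ⊕ Unit)) (ψ : (langA L R).Formula (S ⊕ Unit))
    (hfin : {y | φ.Realize (Sum.elim c fun _ => y)}.Finite) (a : small M)
    (hφ : φ.Realize (Sum.elim c fun _ => (a : M)))
    (hψ : ψ.Realize (Sum.elim (fun i : S => (⟨c i, (hS i).1 i.2⟩ : small M)) fun _ => a)) :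
    ∃ a' : small M', φ.Realize (Sum.elim c' fun _ => (a' : M')) ∧
      ψ.Realize (Sum.elim (fun i : S => (⟨c' i, (hS' i).1 i.2⟩ : small M')) fun _ => a') := by
  obtain ⟨k, hk⟩ := exists_realize_coveredBy hfin
  have hreal : ∀ {N : Type (max u v)} [(langB L K).Structure N] (d : Fin n → N) (y : N),
      (φ ⊓ (coveredBy φ k).relabel Sum.inl : (langB L K).Formula (Fin n ⊕ Unit)).Realize
        (Sum.elim d fun _ => y) ↔
        φ.Realize (Sum.elim d fun _ => y) ∧ (coveredBy φ k).Realize d := fun d y => by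
    rw [Formula.realize_inf, Formula.realize_relabel, Sum.elim_comp_inl]
  -- The types are those of `c` and of its part in `A`. Conjoining `coveredBy φ k` to `φ` makes the
  -- solution set finite for every tuple in every model, as a challenge demands.
  let Q : Challenge Tα Tβ :=
    { n := n
      S := S
      p := Tα.typeOf fun i : S => (⟨c i, (hS i).1 i.2⟩ : small M)
      q := Tβ.typeOf c
      φ := φ ⊓ (coveredBy φ k).relabel Sum.inl
      ψ := ψ
      finite := fun N d _ => by
        simp only [hreal]
        by_cases h : (coveredBy φ k).Realize d
        · exact (finite_of_realize_coveredBy h).subset fun y hy => hy.1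
        · exact Set.finite_empty.subset fun y hy => h hy.2 }
  have hψ' : ∀ (N : Pair Tα Tβ) (d : S → small N) (b : small N),
      Formula.Realize (relativize (K := K) ψ) (Sum.elim (fun i => (d i : N)) fun _ => (b : N)) ↔
        ψ.Realize (Sum.elim d fun _ => b) := by
    intro N d b
    rw [← realize_relativize_formula]
    refine iff_of_eq (congrArg _ ?_)
    ext (i | i) <;> rfl
  have hsol : Q.IsSolution M c a :=
    { contender :=
        { mem_iff := hS
          realizes_q := fun χ hχ => (inType_typeOf Tβ c χ).1 hχ
          realizes_p := fun θ hθ => (realize_relativize_formula M θ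
            fun i : S => (⟨c i, (hS i).1 i.2⟩ : small M)).2 ((inType_typeOf Tα _ θ).1 hθ)
          indep := hi }
      mem := a.2
      holds_φ := (hreal c _).2 ⟨hφ, hk⟩
      holds_ψ := (hψ' M (fun i : S => (⟨c i, (hS i).1 i.2⟩ : small M)) a).2 hψ }
  obtain ⟨a', ha'⟩ := hT Q ⟨M, c, a, hM, hsol⟩ M' c' hM'
    { mem_iff := hS'
      realizes_q := fun χ hχ => (hβ χ).1 ((inType_typeOf Tβ c χ).1 hχ)
      realizes_p := fun θ hθ => (realize_relativize_formula M' θ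
        fun i : S => (⟨c' i, (hS' i).1 i.2⟩ : small M')).2
          ((hα θ).1 ((inType_typeOf Tα _ θ).1 hθ))
      indep := hi' }
  exact ⟨⟨a', ha'.mem⟩, ((hreal c' a').1 ha'.holds_φ).1,
    (hψ' M' (fun i : S => (⟨c' i, (hS' i).1 i.2⟩ : small M')) ⟨a', ha'.mem⟩).1 ha'.holds_ψ⟩

end Pairs

/-! ## Transport of types along partial elementary relations -/

section TypeImage

variable (L : FirstOrder.Language.{u, v}) {M N : Type w} [L.Structure M] [L.Structure N]

/-- A choice of preimages for the elements of the range of `P`. -/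
noncomputable def preimageOf (P : Set (M × N)) (c : (Prod.snd '' P : Set N)) : P :=
  ⟨c.2.choose, c.2.choose_spec.1⟩

theorem snd_preimageOf (P : Set (M × N)) (c : (Prod.snd '' P : Set N)) :
    (preimageOf P c).1.2 = c :=
  c.2.choose_spec.2

/-- The image of the type of `a` over the domain of `P`. -/
def typeImage (P : Set (M × N)) (a : M) : Set (L.Formula ((Prod.snd '' P : Set N) ⊕ Unit)) :=
  {φ | φ.Realize (Sum.elim (fun c => (preimageOf P c).1.1) fun _ => a)}

variable {L} {P : Set (M × N)} {a : M}

theorem PartialElem.preimageOf (h : PartialElem L P) :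
    SameType L (fun c => (preimageOf P c).1.1) fun c : (Prod.snd '' P : Set N) => (c : N) := by
  have := SameType.comp h (MLPair.preimageOf P)
  rwa [show (fun x : P => x.1.2) ∘ MLPair.preimageOf P =
      fun c : (Prod.snd '' P : Set N) => (c : N) from
    funext (snd_preimageOf P)] at this

theorem SameType.isTypeOver {C : Set N} {c : C → M} (h : SameType L c fun x : C => (x : N)) (a : M) :
    IsTypeOver L C {φ : L.Formula (C ⊕ Unit) | φ.Realize (Sum.elim c fun _ => a)} where
  finSat := by
    intro p₀ h₁ h₂
    have : Finite p₀ := h₂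
    obtain ⟨b, hb⟩ := (h.exists_iff (Formula.iInf fun φ : p₀ => φ.1)).1
      ⟨a, Formula.realize_iInf.2 fun φ => h₁ φ.2⟩
    exact ⟨b, fun φ hφ => Formula.realize_iInf.1 hb ⟨φ, hφ⟩⟩
  complete φ := em _

theorem PartialElem.isTypeOver_typeImage (h : PartialElem L P) :
    IsTypeOver L _ (typeImage L P a) :=
  h.preimageOf.isTypeOver a

theorem PartialElem.isNonAlgebraic_typeImage (h : PartialElem L P)
    (ha : a ∉ acl L (Prod.fst '' P)) : IsNonAlgebraic L (typeImage L P a) := by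
  intro φ hφ hfin
  have hfin := (h.preimageOf.finite_iff φ).2 hfin
  refine ha ?_
  rw [mem_acl_image]
  refine ⟨φ.relabel (Sum.map (MLPair.preimageOf P) id), ?_, ?_⟩
  · simp only [realize_relabel_sumMap]
    exact hfin
  · rw [realize_relabel_sumMap]
    exact hφ

theorem PartialElem.insert_of_typeImage (h : PartialElem L P) {b : N}
    (hb : ∀ φ ∈ typeImage L P a, HoldsAt L φ b) : PartialElem L (insert (a, b) P) := by
  refine PartialElem.insert_of_imp fun φ hφ => ?_
  have := hb (φ.relabel (Sum.map (fun x : P => ⟨x.1.2, x, x.2, rfl⟩) id)) (by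
    rw [typeImage, Set.mem_ofPred_eq, realize_relabel_sumMap]
    convert hφ using 2
    ext x
    exact (h.fst_eq_iff (MLPair.preimageOf P _).2 x.2).2 (snd_preimageOf P _))
  rwa [HoldsAt, realize_relabel_sumMap] at this

/-- A formula depends on finitely many parameters only. -/
theorem exists_finset_realize_iff {ι : Type*} (φ : L.Formula (ι ⊕ Unit)) :
    ∃ (F : Finset ι) (φ' : L.Formula (F ⊕ Unit)), ∀ (N : Type w) [L.Structure N] (c : ι → N)
      (f : Unit → N), φ'.Realize (Sum.elim (fun i : F => c i) f) ↔ φ.Realize (Sum.elim c f) := by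
  classical
  let g : φ.freeVarFinset → φ.freeVarFinset.toLeft ⊕ Unit := fun x =>
    match x with
    | ⟨Sum.inl i, hi⟩ => Sum.inl ⟨i, Finset.mem_toLeft.2 hi⟩
    | ⟨Sum.inr i, _⟩ => Sum.inr i
  refine ⟨φ.freeVarFinset.toLeft, BoundedFormula.restrictFreeVar φ g, fun N _ c f => ?_⟩
  refine BoundedFormula.realize_restrictFreeVar _ ?_
  rintro ⟨i | i, hi⟩ <;> rfl

end TypeImage

/-! ## Partial isomorphisms of pairs -/

section Iso

variable {L K : FirstOrder.Language.{u, v}} {R : ℕ → Type v}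
  {Tα : (langA L R).Theory} {Tβ : (langB L K).Theory} {M M' : Pair Tα Tβ}

/-- The restriction of a relation between pairs to the small structures. -/
def restrictA (P : Set (M × M')) : Set (small M × small M') :=
  {x | ((x.1 : M), (x.2 : M')) ∈ P}

/-- The relation `P` is a partial isomorphism of pairs between sets of size less than `κ`, whose
elements outside of `A` are algebraic over elements of `A` and the elements of `X`, which are
independent over `A`. -/
structure IsPartialIso (κ : Cardinal.{max u v}) (P X : Set (M × M')) : Prop where
  card_lt : #P < κ
  elemB : PartialElem (langB L K) P
  elemA : PartialElem (langA L R) (restrictA P)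
  mem_iff : ∀ x ∈ P, x.1 ∈ setA M ↔ x.2 ∈ setA M'
  subset : X ⊆ P
  indep_fst : AclIndep (langB L K) (Prod.fst '' X) (setA M)
  indep_snd : AclIndep (langB L K) (Prod.snd '' X) (setA M')
  span : Prod.fst '' P ⊆ acl (langB L K) (Prod.fst '' (X ∪ {x ∈ P | x.1 ∈ setA M}))

variable {κ : Cardinal.{max u v}} {P X : Set (M × M')}

/-- The field `span` concerns first coordinates only; its mirror image follows because `P`
transports algebraicity. Hence the "back" direction reduces to "forth". -/
theorem IsPartialIso.swap (h : IsPartialIso κ P X) :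
    IsPartialIso κ (Prod.swap ⁻¹' P) (Prod.swap ⁻¹' X) where
  card_lt := by
    refine (Cardinal.mk_preimage_of_injective _ _ Prod.swap_injective).trans_lt h.card_lt
  elemB := h.elemB.swap
  elemA := h.elemA.swap
  mem_iff x hx := (h.mem_iff x.swap hx).symm
  subset := Set.preimage_mono h.subset
  indep_fst := by
    rw [← Set.image_swap_eq_preimage_swap, Set.image_image]
    exact h.indep_snd
  indep_snd := by
    rw [← Set.image_swap_eq_preimage_swap, Set.image_image]
    exact h.indep_fst
  span := by
    have hQ : X ∪ {x ∈ P | x.1 ∈ setA M} ⊆ P := Set.union_subset h.subset fun x hx => hx.1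
    have he : (Prod.swap ⁻¹' X ∪ {x ∈ Prod.swap ⁻¹' P | x.1 ∈ setA M'} : Set (M' × M)) =
        Prod.swap '' (X ∪ {x ∈ P | x.1 ∈ setA M}) := by
      rw [Set.image_swap_eq_preimage_swap, Set.preimage_union]
      congr 1
      ext x
      exact and_congr_right fun hx => (h.mem_iff _ hx).symm
    rw [he, Set.image_image]
    rintro _ ⟨x, hx, rfl⟩
    exact h.elemB.mem_acl hQ hx (h.span ⟨x.swap, hx, rfl⟩)

theorem IsPartialIso.mk_insert_lt (h : IsPartialIso κ P X) (hκ : ℵ₀ ≤ κ) (x : M × M') :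
    #(insert x P : Set (M × M')) < κ :=
  Cardinal.mk_insert_le.trans_lt (Cardinal.add_lt_of_lt hκ h.card_lt
    (Cardinal.one_lt_aleph0.trans_le hκ))

theorem IsPartialIso.span_insert (hg : IsGeometric Tβ) (h : IsPartialIso κ P X) {a : M} {b : M'}
    {Y : Set (M × M')} (hXY : X ⊆ Y)
    (ha : a ∈ acl (langB L K) (Prod.fst '' (Y ∪ {x ∈ insert (a, b) P | x.1 ∈ setA M}))) :
    Prod.fst '' (insert (a, b) P) ⊆
      acl (langB L K) (Prod.fst '' (Y ∪ {x ∈ insert (a, b) P | x.1 ∈ setA M})) := by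
  rw [Set.image_insert_eq]
  refine Set.insert_subset ha (h.span.trans ((hg.isPregeometry M).mono _ _ ?_))
  exact Set.image_mono (Set.union_subset_union hXY fun x hx => ⟨Or.inr hx.1, hx.2⟩)

/-- Extension by elements of `A`. -/
theorem IsPartialIso.insert_small (hg : IsGeometric Tβ) (hκ : ℵ₀ ≤ κ) (h : IsPartialIso κ P X)
    (a : small M) (b : small M')
    (hβ : PartialElem (langB L K) (insert ((a : M), (b : M')) P))
    (hα : PartialElem (langA L R) (insert (a, b) (restrictA P))) :
    IsPartialIso κ (insert ((a : M), (b : M')) P) X where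
  card_lt := h.mk_insert_lt hκ _
  elemB := hβ
  elemA := by
    have : restrictA (insert ((a : M), (b : M')) P) = insert (a, b) (restrictA P) := by
      ext x
      refine or_congr ⟨fun e => ?_, fun e => e ▸ rfl⟩ Iff.rfl
      have e := Prod.ext_iff.1 e
      exact Prod.ext (Subtype.ext e.1) (Subtype.ext e.2)
    rwa [this]
  mem_iff := by
    rintro x (rfl | hx)
    · exact iff_of_true a.2 b.2
    · exact h.mem_iff x hx
  subset := h.subset.trans (Set.subset_insert _ _)
  indep_fst := h.indep_fst
  indep_snd := h.indep_snd
  span := h.span_insert hg subset_rfl ((hg.isPregeometry M).subset_cl _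
    ⟨_, Or.inr ⟨Set.mem_insert _ _, a.2⟩, rfl⟩)

theorem restrictA_insert {a : M} (b : M') (ha : a ∉ setA M) :
    restrictA (insert (a, b) P) = restrictA P := by
  ext x
  refine ⟨fun hx => hx.resolve_left fun e => ha ?_, Or.inr⟩
  have e₁ : (x.1 : M) = a := (Prod.ext_iff.1 e).1
  exact e₁ ▸ x.1.2

/-- Extension by algebraic elements outside of `A`. -/
theorem IsPartialIso.insert_of_mem_acl (hg : IsGeometric Tβ) (hκ : ℵ₀ ≤ κ)
    (h : IsPartialIso κ P X) {a : M} {b : M'} (ha : a ∉ setA M) (hb : b ∉ setA M')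
    (hβ : PartialElem (langB L K) (insert (a, b) P)) (hacl : a ∈ acl (langB L K) (Prod.fst '' P)) :
    IsPartialIso κ (insert (a, b) P) X where
  card_lt := h.mk_insert_lt hκ _
  elemB := hβ
  elemA := (restrictA_insert (P := P) b ha) ▸ h.elemA
  mem_iff := by
    rintro x (rfl | hx)
    · exact iff_of_false ha hb
    · exact h.mem_iff x hx
  subset := h.subset.trans (Set.subset_insert _ _)
  indep_fst := h.indep_fst
  indep_snd := h.indep_snd
  span := by
    have hp := hg.isPregeometry M
    refine h.span_insert hg subset_rfl (hp.mono _ _ ?_ (hp.cl_subset_of_subset_cl h.span hacl))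
    exact Set.image_mono (Set.union_subset_union_right _ fun x hx => ⟨Or.inr hx.1, hx.2⟩)

/-- Extension by elements not algebraic over `A`. -/
theorem IsPartialIso.insert_of_notMem_acl (hg : IsGeometric Tβ) (hκ : ℵ₀ ≤ κ)
    (h : IsPartialIso κ P X) {a : M} {b : M'}
    (hβ : PartialElem (langB L K) (insert (a, b) P))
    (ha : a ∉ acl (langB L K) (setA M ∪ Prod.fst '' P))
    (hb : b ∉ acl (langB L K) (setA M' ∪ Prod.snd '' P)) :
    IsPartialIso κ (insert (a, b) P) (insert (a, b) X) := by
  have hp := hg.isPregeometry M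
  have hp' := hg.isPregeometry M'
  have haA : a ∉ setA M := fun h => ha (hp.subset_cl _ (Or.inl h))
  have hbA : b ∉ setA M' := fun h => hb (hp'.subset_cl _ (Or.inl h))
  exact
  { card_lt := h.mk_insert_lt hκ _
    elemB := hβ
    elemA := (restrictA_insert (P := P) b haA) ▸ h.elemA
    mem_iff := by
      rintro x (rfl | hx)
      · exact iff_of_false haA hbA
      · exact h.mem_iff x hx
    subset := Set.insert_subset_insert h.subset
    indep_fst := by
      rw [Set.image_insert_eq]
      refine h.indep_fst.insert_of_notMem hp fun hx => ha (hp.mono _ _ ?_ hx)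
      exact Set.union_subset_union_right _ (Set.image_mono h.subset)
    indep_snd := by
      rw [Set.image_insert_eq]
      refine h.indep_snd.insert_of_notMem hp' fun hx => hb (hp'.mono _ _ ?_ hx)
      exact Set.union_subset_union_right _ (Set.image_mono h.subset)
    span := h.span_insert hg (Set.subset_insert _ _)
      (hp.subset_cl _ ⟨_, Or.inl (Set.mem_insert _ _), rfl⟩) }

theorem IsPregeometry.exists_finite_subset {Y : Type w} {cl : Set Y → Set Y}
    (h : IsPregeometry cl) {F C : Set Y} (hF : F.Finite) (hFC : F ⊆ cl C) :
    ∃ E ⊆ C, E.Finite ∧ F ⊆ cl E := by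
  choose! E hE using fun x (hx : x ∈ F) => h.finitary C x (hFC hx)
  exact ⟨⋃ x ∈ F, E x, Set.iUnion₂_subset fun x hx => (hE x hx).1,
    hF.biUnion fun x hx => (hE x hx).2.1, fun x hx =>
      h.mono _ _ (Set.subset_biUnion_of_mem hx) (hE x hx).2.2⟩

/-- Every finite part of a partial isomorphism is contained in one whose two sides are
independent from `A` over their intersection with `A`. -/
theorem IsPartialIso.exists_tuple (hg : IsGeometric Tβ) (h : IsPartialIso κ P X)
    {F : Set (M × M')} (hF : F.Finite) (hFP : F ⊆ P) :
    ∃ (n : ℕ) (x : Fin n → M × M'), (∀ i, x i ∈ P) ∧ F ⊆ Set.range x ∧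
      IndepOver (langB L K) (Set.range fun i => (x i).1) (setA M)
        ((fun i => (x i).1) '' {i | (x i).1 ∈ setA M}) ∧
      IndepOver (langB L K) (Set.range fun i => (x i).2) (setA M')
        ((fun i => (x i).2) '' {i | (x i).1 ∈ setA M}) := by
  have hp := hg.isPregeometry M
  have hp' := hg.isPregeometry M'
  obtain ⟨E₁, hE₁, hE₂, hE₃⟩ := hp.exists_finite_subset (hF.image Prod.fst)
    ((Set.image_mono hFP).trans h.span)
  -- `F` is algebraic over a finite `E` consisting of elements of `X` and elements in `A`. The tuple
  -- enumerates `F ∪ E`; it is algebraic over its part in `A` and the independent set `E ∩ X`.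
  obtain ⟨E, hE, hEfin, rfl⟩ := Set.exists_subset_image_finite_and.1 ⟨E₁, hE₁, hE₂, rfl⟩
  have hEP : E ⊆ P := hE.trans (Set.union_subset h.subset fun x hx => hx.1)
  obtain ⟨n, x, -, hx⟩ := (hF.union hEfin).fin_param
  have hxP : ∀ i, x i ∈ P := fun i => by
    have : x i ∈ F ∪ E := hx ▸ Set.mem_range_self i
    exact this.elim (fun h => hFP h) fun h => hEP h
  refine ⟨n, x, hxP, hx ▸ Set.subset_union_left, ?_, ?_⟩
  · refine indepOver_of_subset_acl hp (S := Prod.fst '' (E ∩ X)) ((hEfin.inter_of_left _).image _)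
      (h.indep_fst.subset hp (Set.image_mono Set.inter_subset_right)) ?_ ?_
    · rintro _ ⟨i, hi, rfl⟩
      exact hi
    · have hsub : Prod.fst '' E ⊆ Prod.fst '' (E ∩ X) ∪
          (fun i => (x i).1) '' {i | (x i).1 ∈ setA M} := by
        rintro _ ⟨y, hy, rfl⟩
        rcases hE hy with hyX | hyA
        · exact Or.inl ⟨y, ⟨hy, hyX⟩, rfl⟩
        · obtain ⟨i, rfl⟩ : y ∈ Set.range x := hx ▸ Or.inr hy
          exact Or.inr ⟨i, hyA.2, rfl⟩
      rintro _ ⟨i, rfl⟩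
      have : x i ∈ F ∪ E := hx ▸ Set.mem_range_self i
      rcases this with hi | hi
      · exact hp.mono _ _ hsub (hE₃ ⟨_, hi, rfl⟩)
      · exact hp.subset_cl _ (hsub ⟨_, hi, rfl⟩)
  · refine indepOver_of_subset_acl hp' (S := Prod.snd '' (E ∩ X)) ((hEfin.inter_of_left _).image _)
      (h.indep_snd.subset hp' (Set.image_mono Set.inter_subset_right)) ?_ ?_
    · rintro _ ⟨i, hi, rfl⟩
      exact (h.mem_iff _ (hxP i)).1 hi
    · have hsub : Prod.snd '' E ⊆ Prod.snd '' (E ∩ X) ∪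
          (fun i => (x i).2) '' {i | (x i).1 ∈ setA M} := by
        rintro _ ⟨y, hy, rfl⟩
        rcases hE hy with hyX | hyA
        · exact Or.inl ⟨y, ⟨hy, hyX⟩, rfl⟩
        · obtain ⟨i, rfl⟩ : y ∈ Set.range x := hx ▸ Or.inr hy
          exact Or.inr ⟨i, hyA.2, rfl⟩
      rintro _ ⟨i, rfl⟩
      have : x i ∈ F ∪ E := hx ▸ Set.mem_range_self i
      rcases this with hi | hi
      · exact hp'.mono _ _ hsub (h.elemB.mem_acl hEP (hxP i) (hE₃ ⟨_, hi, rfl⟩))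
      · exact hp'.subset_cl _ (hsub ⟨_, hi, rfl⟩)

end Iso

/-! ## Extending partial isomorphisms -/

section Forth

variable {L K : FirstOrder.Language.{u, v}} {R : ℕ → Type v}
  {Tα : (langA L R).Theory} {Tβ : (langB L K).Theory} {M M' : Pair Tα Tβ}
  {T : (langPair L K R).Theory} {κ : Cardinal.{max u v}} {P X : Set (M × M')}

/-- `φ` and `ψ` use finitely many parameters, which `exists_tuple` places in a finite tuple that is
a contender on both sides. On the first side `a` makes it a solution, so the Mordell–Lang condition
gives one on the second. -/
theorem IsPartialIso.exists_solution (hg : IsGeometric Tβ) (hT : MordellLangCondition Tα Tβ T)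
    (hM : (M : Type _) ⊨ T) (hM' : (M' : Type _) ⊨ T) (h : IsPartialIso κ P X) (a : small M)
    (φ : (langB L K).Formula (P ⊕ Unit)) (ψ : (langA L R).Formula (restrictA P ⊕ Unit))
    (hfin : {y | φ.Realize (Sum.elim (fun x : P => x.1.1) fun _ => y)}.Finite)
    (hφ : φ.Realize (Sum.elim (fun x : P => x.1.1) fun _ => (a : M)))
    (hψ : ψ.Realize (Sum.elim (fun x : restrictA P => x.1.1) fun _ => a)) :
    ∃ a' : small M', φ.Realize (Sum.elim (fun x : P => x.1.2) fun _ => (a' : M')) ∧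
      ψ.Realize (Sum.elim (fun x : restrictA P => x.1.2) fun _ => a') := by
  obtain ⟨F, φ', hφ'⟩ := exists_finset_realize_iff φ
  obtain ⟨G, ψ', hψ'⟩ := exists_finset_realize_iff ψ
  let e : restrictA P → M × M' := fun y => ((y.1.1 : M), (y.1.2 : M'))
  obtain ⟨n, x, hxP, hx, hi, hi'⟩ := h.exists_tuple hg
    (F := Subtype.val '' (F : Set P) ∪ e '' (G : Set (restrictA P)))
    ((F.finite_toSet.image _).union (G.finite_toSet.image _)) (by
      rintro _ (⟨y, -, rfl⟩ | ⟨y, -, rfl⟩)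
      exacts [y.2, y.2])
  have hg₁ : ∀ y : F, ∃ i, x i = y.1.1 := fun y => hx (Or.inl ⟨y, y.2, rfl⟩)
  have hg₂ : ∀ y : G, ∃ i, x i = e y.1 := fun y => hx (Or.inr ⟨y, y.2, rfl⟩)
  choose g₁ hg₁ using hg₁
  choose g₂ hg₂ using hg₂
  let S : Set (Fin n) := {i | (x i).1 ∈ setA M}
  have hS' : ∀ i, i ∈ S ↔ (x i).2 ∈ setA M' := fun i => h.mem_iff _ (hxP i)
  let g₃ : G → S := fun y => ⟨g₂ y, show (x (g₂ y)).1 ∈ setA M from hg₂ y ▸ y.1.1.1.2⟩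
  let k : S → small M × small M' := fun i => (⟨(x i).1, i.2⟩, ⟨(x i).2, (hS' i).1 i.2⟩)
  have hα : SameType (langA L R) (fun i : S => (k i).1) fun i => (k i).2 :=
    h.elemA.sameType k fun i => hxP i
  have e₁ : (fun i => (x i).1) ∘ g₁ = fun y => y.1.1.1 := funext fun y => by simp [hg₁]
  have e₂ : (fun i => (x i).2) ∘ g₁ = fun y => y.1.1.2 := funext fun y => by simp [hg₁]
  have e₃ : (fun i => (k i).1) ∘ g₃ = fun y => y.1.1.1 := funext fun y => Subtype.ext <| by
    change (x (g₂ y)).1 = _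
    rw [hg₂]
  have e₄ : (fun i => (k i).2) ∘ g₃ = fun y => y.1.1.2 := funext fun y => Subtype.ext <| by
    change (x (g₂ y)).2 = _
    rw [hg₂]
  have r₁ : ∀ y, (φ'.relabel (Sum.map g₁ id)).Realize (Sum.elim (fun i => (x i).1) fun _ => y) ↔
      φ.Realize (Sum.elim (fun x : P => x.1.1) fun _ => y) := fun y => by
    rw [realize_relabel_sumMap, e₁, hφ' M (fun x : P => x.1.1)]
  have r₂ : ∀ y, (φ'.relabel (Sum.map g₁ id)).Realize (Sum.elim (fun i => (x i).2) fun _ => y) ↔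
      φ.Realize (Sum.elim (fun x : P => x.1.2) fun _ => y) := fun y => by
    rw [realize_relabel_sumMap, e₂, hφ' M' (fun x : P => x.1.2)]
  have r₃ : ∀ y, (ψ'.relabel (Sum.map g₃ id)).Realize (Sum.elim (fun i => (k i).1) fun _ => y) ↔
      ψ.Realize (Sum.elim (fun x : restrictA P => x.1.1) fun _ => y) := fun y => by
    rw [realize_relabel_sumMap, e₃, hψ' (small M) (fun x : restrictA P => x.1.1)]
  have r₄ : ∀ y, (ψ'.relabel (Sum.map g₃ id)).Realize (Sum.elim (fun i => (k i).2) fun _ => y) ↔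
      ψ.Realize (Sum.elim (fun x : restrictA P => x.1.2) fun _ => y) := fun y => by
    rw [realize_relabel_sumMap, e₄, hψ' (small M') (fun x : restrictA P => x.1.2)]
  obtain ⟨a', h₁, h₂⟩ := hT.exists_solution hM hM' (fun i => (x i).1) (fun i => (x i).2) S
    (fun _ => Iff.rfl) hS' (h.elemB.sameType x hxP) hα hi hi' (φ'.relabel (Sum.map g₁ id))
    (ψ'.relabel (Sum.map g₃ id)) (by simpa only [r₁] using hfin) a ((r₁ _).2 hφ) ((r₃ _).2 hψ)
  exact ⟨a', (r₂ _).1 h₁, (r₄ _).1 h₂⟩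

/-- Forth for algebraic elements of `A`. -/
theorem IsPartialIso.exists_insert_small_of_mem_acl (hg : IsGeometric Tβ)
    (hT : MordellLangCondition Tα Tβ T) (hM : (M : Type _) ⊨ T) (hM' : (M' : Type _) ⊨ T)
    (hκ : ℵ₀ ≤ κ) (hsat : IsSaturated (langPair L K R) M' κ) (h : IsPartialIso κ P X)
    (a : small M) (ha : (a : M) ∈ acl (langB L K) (Prod.fst '' P)) :
    ∃ a' : small M', IsPartialIso κ (insert ((a : M), (a' : M')) P) X := by
  rw [mem_acl_image] at ha
  obtain ⟨φ₀, hφ₀, hφ₀a⟩ := ha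
  -- `p` gathers the pair formulas that follow, for elements of the second `A`, from one `β`-formula
  -- and one `α`-formula true of `a`. A realization therefore lies in `A` and has both transported
  -- types.
  let p : Set ((langPair L K R).Formula (P ⊕ Unit)) := {χ |
    ∃ (φ : (langB L K).Formula (P ⊕ Unit)) (ψ : (langA L R).Formula (restrictA P ⊕ Unit)),
      φ.Realize (Sum.elim (fun x : P => x.1.1) fun _ => (a : M)) ∧
      ψ.Realize (Sum.elim (fun x : restrictA P => x.1.1) fun _ => a) ∧
      ∀ a' : small M', φ.Realize (Sum.elim (fun x : P => x.1.2) fun _ => (a' : M')) →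
        ψ.Realize (Sum.elim (fun x : restrictA P => x.1.2) fun _ => a') →
        χ.Realize (Sum.elim (fun x : P => x.1.2) fun _ => (a' : M'))}
  obtain ⟨b, hb⟩ := hsat.exists_realize h.card_lt (fun x : P => x.1.2) p (by
    intro p₀ hp₀ hfin
    have : Finite p₀ := hfin
    choose φ ψ h₁ h₂ h₃ using fun χ : p₀ => hp₀ χ.2
    -- The conjunct `φ₀`, which witnesses that `a` is algebraic, supplies the finiteness required.
    obtain ⟨a', hφ, hψ⟩ := h.exists_solution hg hT hM hM' a (φ₀ ⊓ Formula.iInf φ) (Formula.iInf ψ)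
      (hφ₀.subset fun y hy => (Formula.realize_inf.1 hy).1)
      (Formula.realize_inf.2 ⟨hφ₀a, Formula.realize_iInf.2 h₁⟩) (Formula.realize_iInf.2 h₂)
    refine ⟨a', fun χ hχ => h₃ ⟨χ, hχ⟩ a' ?_ ?_⟩
    · exact Formula.realize_iInf.1 (Formula.realize_inf.1 hφ).2 _
    · exact Formula.realize_iInf.1 hψ _)
  have hbA : b ∈ setA M' := by
    have := hb (symbA.formula₁ (Term.var (Sum.inr ()))) ⟨⊤, ⊤,
      BoundedFormula.realize_top.2 trivial, BoundedFormula.realize_top.2 trivial,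
      fun a' _ _ => by
        rw [Formula.realize_rel₁]
        exact a'.2⟩
    rw [Formula.realize_rel₁] at this
    exact this
  refine ⟨⟨b, hbA⟩, h.insert_small hg hκ a _ (PartialElem.insert_of_imp fun φ hφ => ?_)
    (PartialElem.insert_of_imp fun ψ hψ => ?_)⟩
  · exact (LHom.realize_onFormula inclBPair φ).1 (hb (inclBPair.onFormula φ)
      ⟨φ, ⊤, hφ, BoundedFormula.realize_top.2 trivial,
        fun a' ha' _ => (LHom.realize_onFormula inclBPair φ).2 ha'⟩)
  · let g : restrictA P → P := fun y => ⟨((y.1.1 : M), (y.1.2 : M')), y.2⟩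
    have key : ∀ a' : small M', (Formula.relabel (Sum.map g id)
        (relativize (K := K) ψ : (langPair L K R).Formula _)).Realize
        (Sum.elim (fun x : P => x.1.2) fun _ => (a' : M')) ↔
        ψ.Realize (Sum.elim (fun x : restrictA P => x.1.2) fun _ => a') := by
      intro a'
      rw [realize_relabel_sumMap, ← realize_relativize_formula]
      refine iff_of_eq (congrArg _ ?_)
      ext (i | i) <;> rfl
    exact (key ⟨b, hbA⟩).1 (hb _ ⟨⊤, ψ, BoundedFormula.realize_top.2 trivial, hψ,
      fun a' _ ha' => (key a').2 ha'⟩)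

/-- Forth for elements of `A` that are not algebraic. -/
theorem IsPartialIso.exists_insert_small_of_notMem_acl (hg : IsGeometric Tβ)
    (hκ : ℵ₀ ≤ κ) (h : IsPartialIso κ P X)
    (hD : ∀ C : Set M', #C < κ → ∀ q : Set ((langB L K).Formula (C ⊕ Unit)),
      IsTypeOver (langB L K) C q → IsNonAlgebraic (langB L K) q → Density M' C q)
    (a : small M) (ha : (a : M) ∉ acl (langB L K) (Prod.fst '' P)) :
    ∃ a' : small M', IsPartialIso κ (insert ((a : M), (a' : M')) P) X := by
  let C : Set M' := Prod.snd '' P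
  -- A parameter in `A ∩ C` comes from an element of `A` because `P` respects `A`. The same
  -- preimages are used for the `α`-type and the `β`-type, so the two can be compared.
  let s : interA M' C → restrictA P := fun c =>
    ⟨(⟨(preimageOf P (interAToC c)).1.1,
      (h.mem_iff _ (preimageOf P (interAToC c)).2).2 (by
        rw [snd_preimageOf]
        exact c.1.2)⟩, c.1), by
      have := (preimageOf P (interAToC c)).2
      have e := snd_preimageOf P (interAToC c)
      rw [← Prod.mk.eta (p := (preimageOf P (interAToC c)).1), e] at this
      exact this⟩
  have hs : SameType (langA L R) (fun c => (s c).1.1) fun c : interA M' C => (c : small M') :=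
    SameType.comp h.elemA s
  obtain ⟨a', ha', h₁, h₂⟩ := hD C (Cardinal.mk_image_le.trans_lt h.card_lt)
    (typeImage (langB L K) P (a : M)) h.elemB.isTypeOver_typeImage
    (h.elemB.isNonAlgebraic_typeImage ha) _ (hs.isTypeOver a) (by
      intro χ hχ hχp
      have := (realize_inclA_formula M hχ _).1 hχp
      rw [typeImage, Set.mem_ofPred_eq, realize_relabel_sumMap]
      convert this using 1
      ext (i | i) <;> rfl)
  refine ⟨⟨a', ha'⟩, h.insert_small hg hκ a _ (h.elemB.insert_of_typeImage h₂)
    (PartialElem.insert_of_imp fun ψ hψ => ?_)⟩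
  let g : restrictA P → interA M' C := fun y => ⟨y.1.2, _, y.2, rfl⟩
  have hgs : ∀ y, (s (g y)).1.1 = y.1.1 := fun y => Subtype.ext
    ((h.elemB.fst_eq_iff (preimageOf P (interAToC (g y))).2 y.2).2 (snd_preimageOf P _))
  have := h₁ (ψ.relabel (Sum.map g id)) (by
    rw [Set.mem_ofPred_eq, realize_relabel_sumMap]
    convert hψ using 2
    exact funext hgs)
  have h₃ := (realize_relativize_formula M' (ψ.relabel (Sum.map g id))
    (Sum.elim (fun c : interA M' C => (c : small M')) fun _ => ⟨a', ha'⟩)).1 (by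
      convert this using 1
      ext (i | i) <;> rfl)
  rwa [realize_relabel_sumMap] at h₃

/-- Forth for elements not algebraic over `A`. -/
theorem IsPartialIso.exists_insert_of_notMem_acl (hg : IsGeometric Tβ)
    (hκ : ℵ₀ ≤ κ) (h : IsPartialIso κ P X)
    (hD : ∀ C : Set M', #C < κ → ∀ q : Set ((langB L K).Formula (C ⊕ Unit)),
      IsTypeOver (langB L K) C q → IsNonAlgebraic (langB L K) q → Codensity M' C q)
    (a : M) (ha : a ∉ acl (langB L K) (setA M ∪ Prod.fst '' P)) :
    ∃ a' : M', IsPartialIso κ (insert (a, a') P) (insert (a, a') X) := by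
  have ha' : a ∉ acl (langB L K) (Prod.fst '' P) := fun h' =>
    ha ((hg.isPregeometry M).mono _ _ Set.subset_union_right h')
  obtain ⟨b, hb, hbq⟩ := hD (Prod.snd '' P) (Cardinal.mk_image_le.trans_lt h.card_lt)
    (typeImage (langB L K) P a) h.elemB.isTypeOver_typeImage
    (h.elemB.isNonAlgebraic_typeImage ha')
  exact ⟨b, h.insert_of_notMem_acl hg hκ (h.elemB.insert_of_typeImage hbq) ha hb⟩

/-- The `β`-type of an element is realized in a saturated pair. -/
theorem PartialElem.exists_insert (hsat : IsSaturated (langPair L K R) M' κ)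
    (hP : PartialElem (langB L K) P) (hcard : #P < κ) (a : M) :
    ∃ b : M', PartialElem (langB L K) (insert (a, b) P) := by
  obtain ⟨b, hb⟩ := hsat.exists_realize hcard (fun x : P => x.1.2)
    (inclBPair.onFormula '' {φ : (langB L K).Formula (P ⊕ Unit) |
      φ.Realize (Sum.elim (fun x : P => x.1.1) fun _ => a)}) (by
    intro p₀ h₁ h₂
    obtain ⟨p₁, h₃, h₄, rfl⟩ := Set.exists_subset_image_finite_and.1 ⟨p₀, h₁, h₂, rfl⟩
    have : Finite p₁ := h₄
    obtain ⟨b, hb⟩ := (SameType.exists_iff hP (Formula.iInf fun φ : p₁ => φ.1)).1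
      ⟨a, Formula.realize_iInf.2 fun φ => h₃ φ.2⟩
    refine ⟨b, ?_⟩
    rintro _ ⟨φ, hφ, rfl⟩
    exact (LHom.realize_onFormula inclBPair φ).2 (Formula.realize_iInf.1 hb ⟨φ, hφ⟩))
  exact ⟨b, PartialElem.insert_of_imp fun φ hφ =>
    (LHom.realize_onFormula inclBPair φ).1 (hb _ ⟨φ, hφ, rfl⟩)⟩

variable (T κ) in
/-- The pair `N` is a `κ`-saturated model of `T`, where `κ` is greater than the cardinality
of `T`. -/
structure IsSaturatedModel (N : Pair Tα Tβ) : Prop where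
  models : (N : Type _) ⊨ T
  card_lt : max ℵ₀ (langPair L K R).card < κ
  saturated : IsSaturated (langPair L K R) N κ

theorem IsSaturatedModel.aleph0_le {N : Pair Tα Tβ} (h : IsSaturatedModel T κ N) : ℵ₀ ≤ κ :=
  (le_max_left _ _).trans h.card_lt.le

/-- Forth for elements of `A`. -/
theorem IsPartialIso.exists_insert_small (hg : IsGeometric Tβ) (hT : IsMLTheory Tα Tβ T)
    (hM : IsSaturatedModel T κ M) (hM' : IsSaturatedModel T κ M') (h : IsPartialIso κ P X)
    (a : small M) : ∃ a' : small M', IsPartialIso κ (insert ((a : M), (a' : M')) P) X := by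
  by_cases ha : (a : M) ∈ acl (langB L K) (Prod.fst '' P)
  · exact h.exists_insert_small_of_mem_acl hg hT.mordellLang hM.models hM'.models hM.aleph0_le
      hM'.saturated a ha
  · exact h.exists_insert_small_of_notMem_acl hg hM.aleph0_le
      (fun C hC q h₁ h₂ => (hT.density_codensity M' κ hM'.models hM'.card_lt hM'.saturated C hC q
        h₁ h₂).1) a ha

theorem IsPartialIso.exists_extend_small (hg : IsGeometric Tβ) (hT : IsMLTheory Tα Tβ T)
    (hM : IsSaturatedModel T κ M) (hM' : IsSaturatedModel T κ M') (h : IsPartialIso κ P X)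
    {F : Set M} (hF : F.Finite) (hFA : F ⊆ setA M) :
    ∃ Q, P ⊆ Q ∧ IsPartialIso κ Q X ∧ F ⊆ Prod.fst '' Q := by
  induction F, hF using Set.Finite.induction_on with
  | empty => exact ⟨P, subset_rfl, h, Set.empty_subset _⟩
  | @insert a F _ _ ih =>
    obtain ⟨Q, hPQ, hQ, hFQ⟩ := ih ((Set.subset_insert _ _).trans hFA)
    obtain ⟨b, hb⟩ := hQ.exists_insert_small hg hT hM hM' ⟨a, hFA (Set.mem_insert _ _)⟩
    refine ⟨_, hPQ.trans (Set.subset_insert _ _), hb, Set.insert_subset ?_ ?_⟩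
    · exact ⟨_, Set.mem_insert _ _, rfl⟩
    · exact hFQ.trans (Set.image_mono (Set.subset_insert _ _))

theorem IsPartialIso.exists_extend_small_snd (hg : IsGeometric Tβ) (hT : IsMLTheory Tα Tβ T)
    (hM : IsSaturatedModel T κ M) (hM' : IsSaturatedModel T κ M') (h : IsPartialIso κ P X)
    {F : Set M'} (hF : F.Finite) (hFA : F ⊆ setA M') :
    ∃ Q, P ⊆ Q ∧ IsPartialIso κ Q X ∧ F ⊆ Prod.snd '' Q := by
  obtain ⟨Q, h₁, h₂, h₃⟩ := h.swap.exists_extend_small hg hT hM' hM hF hFA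
  refine ⟨Prod.swap ⁻¹' Q, fun x hx => h₁ (by simpa using hx), h₂.swap, fun y hy => ?_⟩
  obtain ⟨x, hx, rfl⟩ := h₃ hy
  exact ⟨x.swap, by simpa using hx, rfl⟩

/-- Forth for algebraic elements outside of `A`. -/
theorem IsPartialIso.exists_insert_of_mem_acl (hg : IsGeometric Tβ) (hT : IsMLTheory Tα Tβ T)
    (hM : IsSaturatedModel T κ M) (hM' : IsSaturatedModel T κ M') (h : IsPartialIso κ P X)
    {a : M} (haA : a ∉ setA M) (ha : a ∈ acl (langB L K) (Prod.fst '' P)) :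
    ∃ Q, P ⊆ Q ∧ IsPartialIso κ Q X ∧ a ∈ Prod.fst '' Q := by
  have ha' := ha
  rw [mem_acl_image] at ha'
  obtain ⟨φ, hφ, hφa⟩ := ha'
  have hφ' := (SameType.finite_iff h.elemB φ).1 hφ
  -- The finitely many conjugates of `a` inside the second `A` are first put into the range. If the
  -- image `b` of `a` lay in `A`, it would already be an image, and injectivity would put `a` in the
  -- domain of `Q`.
  obtain ⟨Q, hPQ, hQ, hFQ⟩ := h.exists_extend_small_snd hg hT hM hM'
    (hφ'.inter_of_left (setA M')) Set.inter_subset_right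
  by_cases haQ : a ∈ Prod.fst '' Q
  · exact ⟨Q, hPQ, hQ, haQ⟩
  obtain ⟨b, hb⟩ := PartialElem.exists_insert hM'.saturated hQ.elemB hQ.card_lt a
  have hab : (a, b) ∈ insert (a, b) Q := Set.mem_insert _ _
  have hφb : φ.Realize (Sum.elim (fun x : P => x.1.2) fun _ => b) := by
    have := hb.sameType (Sum.elim (fun x : P => x.1) fun _ : Unit => (a, b)) (by
      rintro (i | i)
      exacts [Or.inr (hPQ i.2), hab]) φ
    have h₁ : (fun i => (Sum.elim (fun x : P => x.1) (fun _ : Unit => (a, b)) i).1) =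
        Sum.elim (fun x : P => x.1.1) fun _ => a := by ext (i | i) <;> rfl
    have h₂ : (fun i => (Sum.elim (fun x : P => x.1) (fun _ : Unit => (a, b)) i).2) =
        Sum.elim (fun x : P => x.1.2) fun _ => b := by ext (i | i) <;> rfl
    rw [h₁, h₂] at this
    exact this.1 hφa
  have hbA : b ∉ setA M' := by
    intro hbA
    obtain ⟨x, hx, hxb⟩ := hFQ ⟨hφb, hbA⟩
    exact haQ ⟨x, hx, (hb.fst_eq_iff (Or.inr hx) hab).2 hxb⟩
  exact ⟨_, hPQ.trans (Set.subset_insert _ _), hQ.insert_of_mem_acl hg hM.aleph0_le haA hbA hb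
    ((hg.isPregeometry M).mono _ _ (Set.image_mono hPQ) ha), _, hab, rfl⟩

/-- When `a ∉ A` is algebraic over `A` and the domain, only finitely many elements of `A` are
involved; once they are added, `a` is algebraic over the new domain. -/
theorem IsPartialIso.exists_extend (hg : IsGeometric Tβ) (hT : IsMLTheory Tα Tβ T)
    (hM : IsSaturatedModel T κ M) (hM' : IsSaturatedModel T κ M') (h : IsPartialIso κ P X)
    (a : M) : ∃ Q Y, P ⊆ Q ∧ IsPartialIso κ Q Y ∧ a ∈ Prod.fst '' Q := by
  by_cases haA : a ∈ setA M
  · obtain ⟨b, hb⟩ := h.exists_insert_small hg hT hM hM' ⟨a, haA⟩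
    exact ⟨_, _, Set.subset_insert _ _, hb, _, Set.mem_insert _ _, rfl⟩
  by_cases ha : a ∈ acl (langB L K) (setA M ∪ Prod.fst '' P)
  · have hp := hg.isPregeometry M
    obtain ⟨E, hE, hEfin, haE⟩ := hp.finitary _ a ha
    obtain ⟨Q, hPQ, hQ, hEQ⟩ := h.exists_extend_small hg hT hM hM' (hEfin.inter_of_left (setA M))
      Set.inter_subset_right
    obtain ⟨Q', h₁, h₂, h₃⟩ := hQ.exists_insert_of_mem_acl hg hT hM hM' haA (hp.mono _ _ (by
      intro x hx
      rcases hE hx with hxA | hxP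
      · exact hEQ ⟨hx, hxA⟩
      · exact Set.image_mono hPQ hxP) haE)
    exact ⟨Q', X, hPQ.trans h₁, h₂, h₃⟩
  · obtain ⟨b, hb⟩ := h.exists_insert_of_notMem_acl hg hM.aleph0_le
      (fun C hC q h₁ h₂ => (hT.density_codensity M' κ hM'.models hM'.card_lt hM'.saturated C hC q
        h₁ h₂).2) a ha
    exact ⟨_, _, Set.subset_insert _ _, hb, _, Set.mem_insert _ _, rfl⟩

theorem IsPartialIso.exists_extend_snd (hg : IsGeometric Tβ) (hT : IsMLTheory Tα Tβ T)
    (hM : IsSaturatedModel T κ M) (hM' : IsSaturatedModel T κ M') (h : IsPartialIso κ P X)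
    (b : M') : ∃ Q Y, P ⊆ Q ∧ IsPartialIso κ Q Y ∧ b ∈ Prod.snd '' Q := by
  obtain ⟨Q, Y, h₁, h₂, h₃⟩ := h.swap.exists_extend hg hT hM' hM b
  refine ⟨Prod.swap ⁻¹' Q, _, fun x hx => h₁ (by simpa using hx), h₂.swap, ?_⟩
  obtain ⟨x, hx, rfl⟩ := h₃
  exact ⟨x.swap, by simpa using hx, rfl⟩

end Forth

/-! ## Elementary equivalence of pairs -/

section Equivalence

variable {L K : FirstOrder.Language.{u, v}} {R : ℕ → Type v}
  {Tα : (langA L R).Theory} {Tβ : (langB L K).Theory} {M M' : Pair Tα Tβ}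
  {T : (langPair L K R).Theory} {κ : Cardinal.{max u v}} {P X : Set (M × M')}

/-- The language of pairs adds only relation symbols to the `β`-language. -/
theorem exists_onTerm_eq {ι : Type w} (t : (langPair L K R).Term ι) :
    ∃ t' : (langB L K).Term ι, inclBPair.onTerm t' = t := by
  induction t with
  | var i => exact ⟨Term.var i, rfl⟩
  | func f ts ih =>
    choose ts' h using ih
    rcases f with f | f
    · exact ⟨Term.func f ts', congrArg (Term.func _) (funext h)⟩
    · exact f.elim

theorem realize_onTerm_sumElim_empty {N : Type w} [(langB L K).Structure N] {n : ℕ}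
    (t : (langB L K).Term (Empty ⊕ Fin n)) (e : Empty → N) (x : Fin n → N) :
    (t.relabel (Sum.elim Empty.elim id)).realize x = t.realize (Sum.elim e x) := by
  rw [Term.realize_relabel]
  congr 1
  ext (i | i)
  · exact i.elim
  · rfl

theorem IsPartialIso.realize_term (h : IsPartialIso κ P X) {n : ℕ} {x : Fin n → M × M'}
    (hx : ∀ i, x i ∈ P) (t : (langPair L K R).Term (Empty ⊕ Fin n)) (e : Empty → M)
    (e' : Empty → M') {y : M × M'} (hy : y ∈ P)
    (hyt : y.1 = t.realize (Sum.elim e fun i => (x i).1)) :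
    y.2 = t.realize (Sum.elim e' fun i => (x i).2) := by
  obtain ⟨t, rfl⟩ := exists_onTerm_eq t
  rw [LHom.realize_onTerm, ← realize_onTerm_sumElim_empty] at hyt ⊢
  let z : Fin n ⊕ Unit → M × M' := Sum.elim x fun _ => y
  have := h.elemB.sameType z (by
    rintro (i | i)
    exacts [hx i, hy])
    ((Term.var (Sum.inr ())).equal ((t.relabel (Sum.elim Empty.elim id)).relabel Sum.inl))
  rw [Formula.realize_equal, Formula.realize_equal, Term.realize_relabel (g := Sum.inl),
    Term.realize_relabel (g := Sum.inl)] at this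
  exact this.1 hyt

theorem IsPartialIso.exists_extend_finite (hg : IsGeometric Tβ) (hT : IsMLTheory Tα Tβ T)
    (hM : IsSaturatedModel T κ M) (hM' : IsSaturatedModel T κ M') (h : IsPartialIso κ P X)
    {F : Set M} (hF : F.Finite) :
    ∃ Q Y, P ⊆ Q ∧ IsPartialIso κ Q Y ∧ F ⊆ Prod.fst '' Q := by
  induction F, hF using Set.Finite.induction_on with
  | empty => exact ⟨P, X, subset_rfl, h, Set.empty_subset _⟩
  | @insert a F _ _ ih =>
    obtain ⟨Q, Y, hPQ, hQ, hFQ⟩ := ih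
    obtain ⟨Q', Y', h₁, h₂, h₃⟩ := hQ.exists_extend hg hT hM hM' a
    exact ⟨Q', Y', hPQ.trans h₁, h₂, Set.insert_subset h₃ (hFQ.trans (Set.image_mono h₁))⟩

/-- Domains of partial isomorphisms need not be closed under functions, so the values of the terms
of an atomic formula are adjoined before it is compared. -/
theorem IsPartialIso.exists_extend_terms (hg : IsGeometric Tβ) (hT : IsMLTheory Tα Tβ T)
    (hM : IsSaturatedModel T κ M) (hM' : IsSaturatedModel T κ M') (h : IsPartialIso κ P X)
    {n k : ℕ} {x : Fin n → M × M'} (hx : ∀ i, x i ∈ P)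
    (t : Fin k → (langPair L K R).Term (Empty ⊕ Fin n)) (e : Empty → M) (e' : Empty → M') :
    ∃ Q Y, IsPartialIso κ Q Y ∧ ∀ j, ((t j).realize (Sum.elim e fun i => (x i).1),
      (t j).realize (Sum.elim e' fun i => (x i).2)) ∈ Q := by
  obtain ⟨Q, Y, hPQ, hQ, hF⟩ := h.exists_extend_finite hg hT hM hM'
    (Set.finite_range fun j => (t j).realize (Sum.elim e fun i => (x i).1))
  refine ⟨Q, Y, hQ, fun j => ?_⟩
  obtain ⟨y, hy, hyt⟩ := hF ⟨j, rfl⟩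
  replace hyt : y.1 = (t j).realize (Sum.elim e fun i => (x i).1) := hyt
  rw [← hyt, ← hQ.realize_term (fun i => hPQ (hx i)) (t j) e e' hy hyt]
  exact hy

/-- `β`-symbols are handled by `elemB`, the symbol `A` by `mem_iff`, and symbols of `R` by `elemA`
for tuples in `A`; on other tuples they fail on both sides by the support axioms. -/
theorem IsPartialIso.relMap_iff (h : IsPartialIso κ P X) {n : ℕ}
    (r : (langPair L K R).Relations n) {x : Fin n → M × M'} (hx : ∀ i, x i ∈ P) :
    Structure.RelMap r (fun i => (x i).1) ↔ Structure.RelMap r fun i => (x i).2 := by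
  rcases r with r | r | r
  · have := h.elemB.sameType x hx (Relations.formula r fun i => Term.var i)
    rw [Formula.realize_rel, Formula.realize_rel] at this
    exact this
  · change Structure.RelMap (symbR r : (langPair L K R).Relations n) _ ↔
      Structure.RelMap (symbR r : (langPair L K R).Relations n) _
    by_cases hA : ∀ i, (x i).1 ∈ setA M
    · let y : Fin n → small M × small M' := fun i =>
        (⟨(x i).1, hA i⟩, ⟨(x i).2, (h.mem_iff _ (hx i)).1 (hA i)⟩)
      have := h.elemA.sameType y hx
        (Relations.formula (L := langA L R) (Sum.inr r : (langA L R).Relations n)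
          fun i => Term.var i)
      exact (Formula.realize_rel.symm.trans this).trans Formula.realize_rel
    · exact iff_of_false (fun h' => hA (mem_setA_of_relMap M r _ h'))
        fun h' => hA fun i => (h.mem_iff _ (hx i)).2 (mem_setA_of_relMap M' r _ h' i)
  · cases r
    have := h.mem_iff _ (hx 0)
    rw [mem_setA_iff, mem_setA_iff] at this
    have e : ∀ {N : Type max u v} (f : Fin 1 → N), f = ![f 0] := fun f => by
      ext i
      fin_cases i
      rfl
    rw [e fun i => (x i).1, e fun i => (x i).2]
    exact this

/-- Induction on `φ` for all partial isomorphisms at once; a quantifier is matched by extending the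
map on the side of the chosen element. -/
theorem IsPartialIso.realize_iff (hg : IsGeometric Tβ) (hT : IsMLTheory Tα Tβ T)
    (hM : IsSaturatedModel T κ M) (hM' : IsSaturatedModel T κ M') {n : ℕ}
    (φ : (langPair L K R).BoundedFormula Empty n) (e : Empty → M) (e' : Empty → M')
    {P X : Set (M × M')} (h : IsPartialIso κ P X) {x : Fin n → M × M'} (hx : ∀ i, x i ∈ P) :
    φ.Realize e (fun i => (x i).1) ↔ φ.Realize e' fun i => (x i).2 := by
  induction φ generalizing P X with
  | falsum => rfl
  | equal t₁ t₂ =>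
    obtain ⟨Q, Y, hQ, ht⟩ := h.exists_extend_terms hg hT hM hM' hx ![t₁, t₂] e e'
    exact hQ.elemB.fst_eq_iff (ht 0) (ht 1)
  | rel r ts =>
    obtain ⟨Q, Y, hQ, ht⟩ := h.exists_extend_terms hg hT hM hM' hx ts e e'
    exact hQ.relMap_iff r ht
  | imp _ _ ih₁ ih₂ => exact imp_congr (ih₁ h hx) (ih₂ h hx)
  | @all n φ ih =>
    have hs : ∀ y : M × M', (Fin.snoc (fun i => (x i).1) y.1 : Fin (n + 1) → M) =
        fun i => ((Fin.snoc x y : Fin (n + 1) → M × M') i).1 := fun y => by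
      ext i
      refine Fin.lastCases ?_ (fun i => ?_) i <;> simp
    have hs' : ∀ y : M × M', (Fin.snoc (fun i => (x i).2) y.2 : Fin (n + 1) → M') =
        fun i => ((Fin.snoc x y : Fin (n + 1) → M × M') i).2 := fun y => by
      ext i
      refine Fin.lastCases ?_ (fun i => ?_) i <;> simp
    have key : ∀ {Q Y : Set (M × M')} (y : M × M'), P ⊆ Q → IsPartialIso κ Q Y → y ∈ Q →
        (φ.Realize e (Fin.snoc (fun i => (x i).1) y.1) ↔
          φ.Realize e' (Fin.snoc (fun i => (x i).2) y.2)) := by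
      intro Q Y y hPQ hQ hy
      rw [hs, hs']
      refine ih hQ fun i => ?_
      refine Fin.lastCases ?_ (fun i => ?_) i
      · simpa using hy
      · simpa using hPQ (hx i)
    rw [BoundedFormula.realize_all, BoundedFormula.realize_all]
    constructor
    · intro H b
      obtain ⟨Q, Y, h₁, h₂, y, hy, rfl⟩ := h.exists_extend_snd hg hT hM hM' b
      exact (key y h₁ h₂ hy).1 (H _)
    · intro H a
      obtain ⟨Q, Y, h₁, h₂, y, hy, rfl⟩ := h.exists_extend hg hT hM hM' a
      exact (key y h₁ h₂ hy).2 (H _)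

theorem sameType_of_isEmpty {L' : FirstOrder.Language.{u, v}} {N N' : Type*} [L'.Structure N]
    [L'.Structure N'] (h : N ≅[L'] N') {ι : Type*} [IsEmpty ι] (c : ι → N) (d : ι → N') :
    SameType L' c d := by
  intro φ
  have := elementarilyEquivalent_iff.1 h (φ.relabel (isEmptyElim : ι → Empty))
  rw [Sentence.Realize, Sentence.Realize, Formula.realize_relabel, Formula.realize_relabel] at this
  convert this using 2

theorem isPartialIso_empty (hκ : ℵ₀ ≤ κ) (hB : M ≅[langB L K] M')
    (hA : small M ≅[langA L R] small M') : IsPartialIso κ (∅ : Set (M × M')) ∅ where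
  card_lt := by
    rw [Cardinal.mk_eq_zero]
    exact Cardinal.aleph0_pos.trans_le hκ
  elemB := sameType_of_isEmpty hB _ _
  elemA := by
    have : IsEmpty (restrictA (∅ : Set (M × M'))) := ⟨fun x => x.2.elim⟩
    exact sameType_of_isEmpty hA _ _
  mem_iff := fun x hx => hx.elim
  subset := subset_rfl
  indep_fst := by simp [AclIndep]
  indep_snd := by simp [AclIndep]
  span := by simp

theorem elementarilyEquivalent_of_components (hg : IsGeometric Tβ) (hT : IsMLTheory Tα Tβ T)
    (hM : IsSaturatedModel T κ M) (hM' : IsSaturatedModel T κ M') (hB : M ≅[langB L K] M')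
    (hA : small M ≅[langA L R] small M') : M ≅[langPair L K R] M' := by
  rw [elementarilyEquivalent_iff]
  intro φ
  have := (isPartialIso_empty hM.aleph0_le hB hA).realize_iff hg hT hM hM' φ default default
    (x := Fin.elim0) (fun i => i.elim0)
  rw [Sentence.Realize, Sentence.Realize, Formula.Realize, Formula.Realize]
  convert this using 2

theorem exists_isSaturatedModel (hT : IsMLTheory Tα Tβ T)
    (N : Theory.ModelType.{u, v, max u v} T) :
    ∃ M : Pair Tα Tβ, (N ≅[langPair L K R] M) ∧
      IsSaturatedModel T (Order.succ (max ℵ₀ (langPair L K R).card)) M := by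
  obtain ⟨M, _, _, hNM, hM⟩ := exists_isSaturated (langPair L K R) N
    (max ℵ₀ (langPair L K R).card) (le_max_left _ _)
  have hMT : M ⊨ T := hNM.theory_model
  have : M ⊨ pairTheory Tα Tβ := ⟨fun σ hσ =>
    (hT.extends_pairTheory σ hσ).realize_sentence M⟩
  exact ⟨Theory.ModelType.of (pairTheory Tα Tβ) M, hNM, hMT, Order.lt_succ _, hM⟩

/-! ### Completeness of `T` and of its component theories -/

theorem realize_of_mem_theoryA {M : Pair Tα Tβ} (hM : (M : Type _) ⊨ T) :
    small M ⊨ (theoryA T : (langA L R).Theory) :=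
  ⟨fun φ hφ => (realize_relativize_sentence M φ).1 (Theory.ModelsBoundedFormula.realize_sentence hφ M)⟩

theorem realize_of_mem_theoryB {M : Pair Tα Tβ} (hM : (M : Type _) ⊨ T) :
    (M : Type _) ⊨ (theoryB T : (langB L K).Theory) :=
  ⟨fun φ hφ => (LHom.realize_onSentence M inclBPair φ).1
    (Theory.ModelsBoundedFormula.realize_sentence hφ M)⟩

theorem isComplete_of_components (hg : IsGeometric Tβ) (hT : IsMLTheory Tα Tβ T)
    (hsat : T.IsSatisfiable) (hA : (theoryA T : (langA L R).Theory).IsComplete)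
    (hB : (theoryB T : (langB L K).Theory).IsComplete) : T.IsComplete := by
  refine Theory.IsComplete.isComplete_iff_models_elementarily_equivalent.2 ⟨hsat, fun N N' => ?_⟩
  obtain ⟨M, hNM, hM⟩ := exists_isSaturatedModel hT N
  obtain ⟨M', hNM', hM'⟩ := exists_isSaturatedModel hT N'
  have := realize_of_mem_theoryA hM.models
  have := realize_of_mem_theoryA hM'.models
  have := realize_of_mem_theoryB hM.models
  have := realize_of_mem_theoryB hM'.models
  exact (hNM.trans (elementarilyEquivalent_of_components hg hT hM hM'
    (hB.models_elementarily_equivalent M M')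
    (hA.models_elementarily_equivalent (small M) (small M')))).trans hNM'.symm

/-- A theory with more consequences than a complete theory is complete if it is satisfiable. -/
theorem isComplete_of_models {L' : FirstOrder.Language.{u, v}} {S S' : L'.Theory}
    (hS : S.IsComplete) (hS' : S'.IsSatisfiable) (h : ∀ φ ∈ S, S' ⊨ᵇ φ) : S'.IsComplete := by
  have key : ∀ φ : L'.Sentence, S ⊨ᵇ φ → S' ⊨ᵇ φ := fun φ hφ =>
    Theory.models_sentence_iff.2 fun N => by
      have : N ⊨ S := ⟨fun ψ hψ => (h ψ hψ).realize_sentence N⟩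
      exact hφ.realize_sentence N
  exact ⟨hS', fun φ => (hS.2 φ).imp (key _) (key _)⟩

theorem exists_pair (hT : IsMLTheory Tα Tβ T) (hsat : T.IsSatisfiable) :
    ∃ M : Pair Tα Tβ, (M : Type _) ⊨ T := by
  obtain ⟨N⟩ := hsat
  have : N ⊨ pairTheory Tα Tβ := ⟨fun σ hσ =>
    (hT.extends_pairTheory σ hσ).realize_sentence N⟩
  exact ⟨Theory.ModelType.of (pairTheory Tα Tβ) N, N.is_model⟩

theorem isSatisfiable_theoryA (hT : IsMLTheory Tα Tβ T) (hsat : T.IsSatisfiable) :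
    (theoryA T : (langA L R).Theory).IsSatisfiable := by
  obtain ⟨M, hM⟩ := exists_pair hT hsat
  have := realize_of_mem_theoryA hM
  exact Theory.Model.isSatisfiable (small M)

theorem isSatisfiable_theoryB (hT : IsMLTheory Tα Tβ T) (hsat : T.IsSatisfiable) :
    (theoryB T : (langB L K).Theory).IsSatisfiable := by
  obtain ⟨M, hM⟩ := exists_pair hT hsat
  have := realize_of_mem_theoryB hM
  exact Theory.Model.isSatisfiable M

/-- Relativization commutes with negation by definition, so a decision of `T` about `θ_A` is one of
`T_𝒜` about `θ`. -/
theorem isComplete_theoryA (hT : IsMLTheory Tα Tβ T) (h : T.IsComplete) :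
    (theoryA T : (langA L R).Theory).IsComplete :=
  ⟨isSatisfiable_theoryA hT h.1, fun φ => (h.2 (relativize φ)).imp
    (fun hφ => Theory.models_sentence_of_mem hφ) fun hφ => Theory.models_sentence_of_mem hφ⟩

theorem isComplete_theoryB (hT : IsMLTheory Tα Tβ T) (h : T.IsComplete) :
    (theoryB T : (langB L K).Theory).IsComplete :=
  ⟨isSatisfiable_theoryB hT h.1, fun φ => (h.2 (inclBPair.onSentence φ)).imp
    (fun hφ => Theory.models_sentence_of_mem hφ) fun hφ => Theory.models_sentence_of_mem hφ⟩

/-- Since `T` extends `T²`, the theories `T_𝒜` and `T_ℬ` contain `Tα` and `Tβ`, and they are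
satisfiable; so they inherit completeness. -/
theorem isComplete_of_isComplete (hg : IsGeometric Tβ) (hT : IsMLTheory Tα Tβ T)
    (hsat : T.IsSatisfiable) (hα : Tα.IsComplete) (hβ : Tβ.IsComplete) : T.IsComplete :=
  isComplete_of_components hg hT hsat
    (isComplete_of_models hα (isSatisfiable_theoryA hT hsat) fun φ hφ =>
      Theory.models_sentence_of_mem (hT.extends_pairTheory _
        (Or.inl (Or.inl (Or.inr ⟨φ, Theory.models_sentence_of_mem hφ, rfl⟩)))))
    (isComplete_of_models hβ (isSatisfiable_theoryB hT hsat) fun φ hφ =>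
      Theory.models_sentence_of_mem (hT.extends_pairTheory _
        (Or.inl (Or.inl (Or.inl ⟨φ, hφ, rfl⟩)))))

end Equivalence

end MLPair

theorem mainTheorem9 (L K : FirstOrder.Language.{u, v}) (R : ℕ → Type v)
    (Tα : (MLPair.langA L R).Theory) (Tβ : (MLPair.langB L K).Theory)
    (hgeom : MLPair.IsGeometric Tβ)
    (T : (MLPair.langPair L K R).Theory) (hcons : T.IsSatisfiable)
    (hML : MLPair.IsMLTheory Tα Tβ T) :
    (Tα.IsComplete ∧ Tβ.IsComplete → T.IsComplete) ∧
    (T.IsComplete ↔ (MLPair.theoryA T).IsComplete ∧ (MLPair.theoryB T).IsComplete) ∧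
    ((∀ φ ∈ MLPair.theoryA T, Tα ⊨ᵇ φ) → (∀ φ ∈ MLPair.theoryB T, Tβ ⊨ᵇ φ) →
      (T.IsComplete ↔ Tα.IsComplete ∧ Tβ.IsComplete)) := by
  refine ⟨fun h => MLPair.isComplete_of_isComplete hgeom hML hcons h.1 h.2,
    ⟨fun h => ⟨MLPair.isComplete_theoryA hML h, MLPair.isComplete_theoryB hML h⟩,
      fun h => MLPair.isComplete_of_components hgeom hML hcons h.1 h.2⟩,
    fun hA hB => ⟨fun h => ?_,
      fun h => MLPair.isComplete_of_isComplete hgeom hML hcons h.1 h.2⟩⟩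
  -- The components of any pair show that `Tα` and `Tβ` are satisfiable; as they entail the complete
  -- theories `T_𝒜` and `T_ℬ`, they are complete.
  obtain ⟨M, -⟩ := MLPair.exists_pair hML hcons
  exact ⟨MLPair.isComplete_of_models (MLPair.isComplete_theoryA hML h)
      (Theory.Model.isSatisfiable (MLPair.small M)) hA,
    MLPair.isComplete_of_models (MLPair.isComplete_theoryB hML h)
      (Theory.Model.isSatisfiable M) hB⟩
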